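/- **Theorem (least favorable densities in $D^2_{\varepsilon_1}\times D^2_{\varepsilon_2}$).** *Setting.* Let $s\ge 0$, let $N_l,K_l\ge 0$ with $N_0=K_0=0$, put $M_l=\sum_{k=0}^{l}(N_k+K_k)$, $S=\bigcup_{l=1}^s[-M_l-N_l,-M_l]$, $S^+=\bigcup_{l=1}^s[M_l,M_l+N_l]$, $R^s=[0,\infty)\setminus S^+$, $T=S\cup[0,\infty)$. Let $a:R^s\to\mathbb C$ satisfy $\int_{R^s}|a|\,dt<\infty$, $\int_{R^s}t|a|^2dt<\infty$, and let $A(e^{i\lambda})=\int_{R^s}a(t)e^{-it\lambda}dt$. A spectral density is a nonnegative integrable function on $\mathbb R$. For spectral densities $f,g$ (of uncorrelated zero-mean stationary processes $\xi,\eta$), let $L_2^s(f+g)$ be the closed span in $L_2(f+g)$ of $e^{it\lambda}$, $t\in(-\infty,0)\setminus S$, and for $h\in L_2^s(f+g)$ let $$\Delta(h;f,g)=\frac1{2\pi}\int_{\mathbb R}|A-h|^2f\,d\lambda+\frac1{2\pi}\int_{\mathbb R}|h|^2g\,d\lambda ,$$ which is the mean-square error of the linear estimate of $A\xi=\int_{R^s}a(t)\xi(-t)dt$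 with spectral characteristic $h$ from $\xi(t)+\eta(t)$, $t\in(-\infty,0)\setminus S$. Let $h(f,g)$ be its minimizer over $L_2^s(f+g)$. For a set $D$ of pairs of densities, $(f_0,g_0)\in D$ is *least favorable in $D$* if $\Delta(h(f_0,g_0);f_0,g_0)=\max_{(f,g)\in D}\Delta(h(f,g);f,g)$. With $H_D=\bigcap_{(f,g)\in D}L_2^s(f+g)$, a function $h^0$ is *minimax-robust* if $h^0\in H_D$, $\max_{(f,g)\in D}\Delta(h^0;f,g)$ is attained, and it equals $\min_{h\in H_D}\sup_{(f,g)\in D}\Delta(h;f,g)$. The pair $(f,g)$ satisfies the *minimality condition* if $\int_{\mathbb R}|\gamma|^2/(f+g)\,d\lambda<\infty$ for some function $\gamma(\lambda)=\int_0^\tau\alpha(t)e^{it\lambda}dt\not\equiv0$ with $\tau>0$ and $\alpha$ integrable. Let $\mathbf B,\mathbf R,\mathbf Q$ be the operators for functions on $T$ with the kernels $$\frac1{2\pi}\int\frac{e^{i\lambda(u-t)}}{f+g}d\lambda,\qquad \frac1{2\pi}\int\frac{e^{-i\lambda(u+t)}f}{f+g}d\lambda,\qquad \frac1{2\pi}\int\frac{e^{i\lambda(t-u)}fg}{f+g}d\lambda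 ,$$ $\mathbf B$ and $\mathbf R$ being understood in the weak sense. That is: functions $x$ on $T$ are given by their transforms $X(\lambda)=\int_T x(t)e^{it\lambda}dt$; the functions of finite energy are those given by measurable $X$ with $\int|X|^2/(f+g)\,d\lambda<\infty$ and $\int X(\lambda)e^{-it\lambda}d\lambda=0$ for $t\in(-\infty,0)\setminus S$; and, with $a$ extended by zero, $$\langle\mathbf Bx,y\rangle=\frac1{2\pi}\int\frac{X\overline Y}{f+g}d\lambda,\qquad \langle\mathbf Ra,y\rangle=\frac1{2\pi}\int\frac{A f\,\overline Y}{f+g}d\lambda .$$ The function $\mathbf c=\mathbf B^{-1}\mathbf Ra$ is the function of finite energy with $\langle\mathbf B\mathbf c,y\rangle=\langle\mathbf Ra,y\rangle$ for all $y$ of finite energy, and $C(e^{i\lambda})=\int_T\mathbf c(t)e^{it\lambda}dt$ is its transform. Put $$\text{(4)}\qquad h(e^{i\lambda})=A(e^{i\lambda})\frac{f(\lambda)}{f(\lambda)+g(\lambda)}-\frac{C(e^{i\lambda})}{f(\lambda)+g(\lambda)} .$$ *Claim.* Let $f_1,g_1$ be spectral densities, and let $D=D^2_{\varepsilon_1}\times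 D^2_{\varepsilon_2}$, where $D^2_{\varepsilon_1}$ and $D^2_{\varepsilon_2}$ are the sets of spectral densities $f$ and $g$ with $\frac1{2\pi}\int|f-f_1|^2d\lambda\le\varepsilon_1$ and $\frac1{2\pi}\int|g-g_1|^2d\lambda\le\varepsilon_2$. Let $(f_0,g_0)\in D$ satisfy the minimality condition, let $C^0$ be the function $C$ of $(f_0,g_0)$, and let $|Ag_0+C^0|^2/(f_0+g_0)^2$ and $|Af_0-C^0|^2/(f_0+g_0)^2$ be (essentially) bounded. Suppose that for constants $\alpha_1,\alpha_2\ge0$ and an exponent $p\in\{1,2\}$, almost everywhere, $$|Ag_0+C^0|^p=(f_0+g_0)^2(f_0-f_1)\alpha_1,\qquad |Af_0-C^0|^p=(f_0+g_0)^2(g_0-g_1)\alpha_2 ,$$ that $$\frac1{2\pi}\int|f_0-f_1|^2d\lambda=\varepsilon_1,\qquad \frac1{2\pi}\int|g_0-g_1|^2d\lambda=\varepsilon_2 ,$$ and that $(f_0,g_0)$ solves the optimization problem $$\text{(extrem)}\qquad \max_{(f,g)}\ \langle\mathbf Ra,\mathbf B^{-1}\mathbf Ra\rangle+\langle\mathbf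 Qa,a\rangle ,$$ the maximum being over the pairs $(f,g)\in D$ that satisfy the minimality condition. Then $(f_0,g_0)$ is least favorable in $D$, and the function (4) for $(f_0,g_0)$ is the optimal spectral characteristic $h(f_0,g_0)$ and is minimax-robust. -/

import Mathlib

open MeasureTheory Set
open scoped ENNReal ComplexConjugate

noncomputable section

namespace MissingFilter

/-! ### Time sets -/

/-- `M_l = ∑_{k=0}^{l} (N_k + K_k)`. -/
def gapStart (N K : ℕ → ℝ) (l : ℕ) : ℝ := ∑ k ∈ Finset.range (l + 1), (N k + K k)

/-- The times of missing observations, `S = ⋃_{l=1}^{s} [-M_l - N_l, -M_l]`. -/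
def gapSet (s : ℕ) (N K : ℕ → ℝ) : Set ℝ :=
  ⋃ l ∈ Finset.Icc 1 s, Icc (-gapStart N K l - N l) (-gapStart N K l)

/-- The reflected set `S⁺ = ⋃_{l=1}^{s} [M_l, M_l + N_l]`. -/
def gapSetPos (s : ℕ) (N K : ℕ → ℝ) : Set ℝ :=
  ⋃ l ∈ Finset.Icc 1 s, Icc (gapStart N K l) (gapStart N K l + N l)

/-- `R^s = [0, ∞) \ S⁺`, the domain of the weight `a` of the functional. -/
def weightSet (s : ℕ) (N K : ℕ → ℝ) : Set ℝ := Ici 0 \ gapSetPos s N K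

/-- The observation times `ℝ⁻ \ S`. -/
def obsTimes (s : ℕ) (N K : ℕ → ℝ) : Set ℝ := Iio 0 \ gapSet s N K

/-- `T = S ∪ [0, ∞)`. -/
def timeSet (s : ℕ) (N K : ℕ → ℝ) : Set ℝ := gapSet s N K ∪ Ici 0

/-- The exponential `ω ↦ e^{itω}`. -/
def expi (t : ℝ) (ω : ℝ) : ℂ := Complex.exp (Complex.I * t * ω)

/-! ### Spectral densities -/

/-- A spectral density on the line: nonnegative and integrable. -/
def IsSpectralDensity (f : ℝ → ℝ) : Prop := (∀ᵐ ω, 0 ≤ f ω) ∧ Integrable f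

/-- The minimality condition: `∫ |γ|² / (f + g) < ∞` for a nontrivial function `γ` of exponential
type, `γ(ω) = ∫_0^τ α(t) e^{itω} dt`.  The quotient is taken in `[0, ∞]`, so that it is `∞`
where `f + g = 0` and `γ ≠ 0`. -/
def Minimality (f g : ℝ → ℝ) : Prop :=
  ∃ (τ : ℝ) (α : ℝ → ℂ), IntegrableOn α (Icc 0 τ) ∧
    (∃ ω, (∫ t in Icc 0 τ, α t * expi t ω) ≠ 0) ∧
    (∫⁻ ω, ‖∫ t in Icc 0 τ, α t * expi t ω‖ₑ ^ 2 / ENNReal.ofReal (f ω + g ω)) < ∞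

/-- The class `D_ε²` of the spectral densities `f` with `(1/2π) ∫ |f - f₁|² ≤ ε`. -/
def L2Ball (f₁ : ℝ → ℝ) (ε : ℝ) : Set (ℝ → ℝ) :=
  {f | IsSpectralDensity f ∧ Integrable (fun ω => |f ω - f₁ ω| ^ 2) ∧
    1 / (2 * Real.pi) * (∫ ω, |f ω - f₁ ω| ^ 2) ≤ ε}

/-! ### The filtering problem -/

/-- `A(e^{iω}) = ∫_{R^s} a(t) e^{-itω} dt`. -/
def weightSymbol (s : ℕ) (N K : ℕ → ℝ) (a : ℝ → ℂ) (ω : ℝ) : ℂ :=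
  ∫ t in weightSet s N K, a t * expi (-t) ω

/-- The measure with density `f + g`. -/
def sumMeasure (f g : ℝ → ℝ) : Measure ℝ :=
  volume.withDensity (fun ω => ENNReal.ofReal (f ω + g ω))

/-- `L_2^s(f + g)`: the closed linear span in `L_2(f + g)` of `e^{itω}`, `t ∈ ℝ⁻ \ S`. -/
def obsSpace (s : ℕ) (N K : ℕ → ℝ) (f g : ℝ → ℝ) : Set (ℝ → ℂ) :=
  {h | MemLp h 2 (sumMeasure f g) ∧ ∀ δ : ℝ≥0∞, 0 < δ →
    ∃ p ∈ Submodule.span ℂ (expi '' obsTimes s N K), eLpNorm (h - p) 2 (sumMeasure f g) < δ}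

/-- The mean-square error
`Δ(h; f, g) = (1/2π) ∫ |A - h|² f dω + (1/2π) ∫ |h|² g dω` of the linear estimate with spectral
characteristic `h`, for the functional with symbol `A`. -/
def mse (A h : ℝ → ℂ) (f g : ℝ → ℝ) : ℝ≥0∞ :=
  ENNReal.ofReal (1 / (2 * Real.pi)) * (∫⁻ ω, ‖A ω - h ω‖ₑ ^ 2 * ENNReal.ofReal (f ω)) +
    ENNReal.ofReal (1 / (2 * Real.pi)) * (∫⁻ ω, ‖h ω‖ₑ ^ 2 * ENNReal.ofReal (g ω))

/-- `h = h(f, g)` is the spectral characteristic of the mean-square optimal linear estimate. -/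
def IsOptimal (s : ℕ) (N K : ℕ → ℝ) (a : ℝ → ℂ) (f g : ℝ → ℝ) (h : ℝ → ℂ) : Prop :=
  h ∈ obsSpace s N K f g ∧ ∀ h' ∈ obsSpace s N K f g,
    mse (weightSymbol s N K a) h f g ≤ mse (weightSymbol s N K a) h' f g

/-- `(f₀, g₀) ∈ D` is least favorable in `D`:
`Δ(h(f₀, g₀); f₀, g₀) = max_{(f, g) ∈ D} Δ(h(f, g); f, g)`. -/
def IsLeastFavorable (s : ℕ) (N K : ℕ → ℝ) (a : ℝ → ℂ) (D : Set ((ℝ → ℝ) × (ℝ → ℝ)))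
    (f₀ g₀ : ℝ → ℝ) : Prop :=
  (f₀, g₀) ∈ D ∧ ∃ h₀, IsOptimal s N K a f₀ g₀ h₀ ∧
    IsGreatest {e | ∃ f g h, (f, g) ∈ D ∧ IsOptimal s N K a f g h ∧
      e = mse (weightSymbol s N K a) h f g} (mse (weightSymbol s N K a) h₀ f₀ g₀)

/-- `H_D = ⋂_{(f, g) ∈ D} L_2^s(f + g)`. -/
def commonSpace (s : ℕ) (N K : ℕ → ℝ) (D : Set ((ℝ → ℝ) × (ℝ → ℝ))) : Set (ℝ → ℂ) :=
  ⋂ q ∈ D, obsSpace s N K q.1 q.2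

/-- `h₀` is minimax-robust: `h₀ ∈ H_D` and
`min_{h ∈ H_D} max_{(f, g) ∈ D} Δ(h; f, g) = max_{(f, g) ∈ D} Δ(h₀; f, g)`.
The maximum for `h₀` is required to be attained; for the other `h` it is a supremum in `[0, ∞]`. -/
def IsMinimaxRobust (s : ℕ) (N K : ℕ → ℝ) (a : ℝ → ℂ) (D : Set ((ℝ → ℝ) × (ℝ → ℝ)))
    (h₀ : ℝ → ℂ) : Prop :=
  h₀ ∈ commonSpace s N K D ∧
  ∃ m : ℝ≥0∞,
    IsGreatest ((fun q : (ℝ → ℝ) × (ℝ → ℝ) => mse (weightSymbol s N K a) h₀ q.1 q.2) '' D) m ∧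
    IsLeast ((fun h => ⨆ q ∈ D, mse (weightSymbol s N K a) h q.1 q.2) '' commonSpace s N K D) m

/-! ### The operators `B`, `R`, `Q`

Since `f + g` is integrable, `1 / (f + g)` is not, and `B` and `R` are operators with the Fourier
symbols `1 / (f + g)` and `f / (f + g)`, given by their pairings with the functions on `T` of finite
energy.  A function `c` on `T` is represented by its transform
`C(ω) = ∫_T c(t) e^{itω} dt`, `c(t) = (1/2π) ∫ C(ω) e^{-itω} dω`. -/

/-- `C` is the transform of a function `c` that vanishes outside `T` and has finite energy
`∫ |C|² / (f + g) < ∞` (in particular `C` is integrable, as `f + g` is). -/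
def IsSymbolOn (s : ℕ) (N K : ℕ → ℝ) (f g : ℝ → ℝ) (C : ℝ → ℂ) : Prop :=
  AEStronglyMeasurable C ∧
  (∫⁻ ω, ‖C ω‖ₑ ^ 2 / ENNReal.ofReal (f ω + g ω)) < ∞ ∧
  ∀ t ∉ timeSet s N K, 1 / (2 * Real.pi) * (∫ ω, C ω * expi (-t) ω) = 0

/-- `⟨B x, y⟩`, where `B` has the kernel `(1/2π) ∫ e^{iω(u - t)} / (f + g) dω` and `X`, `Y` are the
transforms of `x`, `y`. -/
def pairB (f g : ℝ → ℝ) (X Y : ℝ → ℂ) : ℂ :=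
  1 / (2 * Real.pi) * ∫ ω, X ω * conj (Y ω) * ((1 / (f ω + g ω) : ℝ) : ℂ)

/-- `⟨R a, y⟩`, where `R` has the kernel `(1/2π) ∫ e^{-iω(u + t)} f / (f + g) dω` and `Y` is the
transform of `y`; `∫ a(u) e^{-iωu} du = A(e^{iω})`. -/
def pairR (s : ℕ) (N K : ℕ → ℝ) (a : ℝ → ℂ) (f g : ℝ → ℝ) (Y : ℝ → ℂ) : ℂ :=
  1 / (2 * Real.pi) *
    ∫ ω, weightSymbol s N K a ω * conj (Y ω) * ((f ω / (f ω + g ω) : ℝ) : ℂ)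

/-- `c = B⁻¹ R a`, i.e. `B c = R a` on `T`, with `C` the transform of `c`. -/
def IsInvBR (s : ℕ) (N K : ℕ → ℝ) (a : ℝ → ℂ) (f g : ℝ → ℝ) (C : ℝ → ℂ) : Prop :=
  IsSymbolOn s N K f g C ∧
    ∀ Y, IsSymbolOn s N K f g Y → pairB f g C Y = pairR s N K a f g Y

/-- The function `𝐚` on `T`: `a` on `R^s`, zero on `S` and `S⁺`. -/
def extWeight (s : ℕ) (N K : ℕ → ℝ) (a : ℝ → ℂ) : ℝ → ℂ :=
  (weightSet s N K \ gapSet s N K).indicator a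

/-- The kernel `(1/2π) ∫ e^{iω(t - u)} f g / (f + g) dω` of `Q`. -/
def kernelQ (f g : ℝ → ℝ) (t u : ℝ) : ℂ :=
  1 / (2 * Real.pi) * ∫ ω, expi (t - u) ω * ((f ω * g ω / (f ω + g ω) : ℝ) : ℂ)

/-- `(Q x)(t) = ∫_T x(u) q(t, u) du`. -/
def opQ (s : ℕ) (N K : ℕ → ℝ) (f g : ℝ → ℝ) (x : ℝ → ℂ) (t : ℝ) : ℂ :=
  ∫ u in timeSet s N K, x u * kernelQ f g t u

/-- `⟨R a, B⁻¹ R a⟩ + ⟨Q a, a⟩`, with `C` the transform of `B⁻¹ R a`. -/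
def extremValue (s : ℕ) (N K : ℕ → ℝ) (a : ℝ → ℂ) (f g : ℝ → ℝ) (C : ℝ → ℂ) : ℝ :=
  (pairR s N K a f g C +
    ∫ t in timeSet s N K,
      opQ s N K f g (extWeight s N K a) t * conj (extWeight s N K a t)).re

/-- `(f₀, g₀)`, with `C₀` the transform of `(B⁰)⁻¹ R⁰ a`, solves the optimization problem
`max_{(f, g) ∈ D} ⟨R a, B⁻¹ R a⟩ + ⟨Q a, a⟩`; the maximum is over the pairs of `D` that satisfy the
minimality condition. -/
def SolvesExtrem (s : ℕ) (N K : ℕ → ℝ) (a : ℝ → ℂ) (D : Set ((ℝ → ℝ) × (ℝ → ℝ)))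
    (f₀ g₀ : ℝ → ℝ) (C₀ : ℝ → ℂ) : Prop :=
  IsGreatest {v | ∃ f g C, (f, g) ∈ D ∧ Minimality f g ∧ IsInvBR s N K a f g C ∧
    v = extremValue s N K a f g C} (extremValue s N K a f₀ g₀ C₀)

/-- The spectral characteristic `h = A f / (f + g) - C / (f + g)`. -/
def charFormula (s : ℕ) (N K : ℕ → ℝ) (a : ℝ → ℂ) (f g : ℝ → ℝ) (C : ℝ → ℂ) (ω : ℝ) : ℂ :=
  weightSymbol s N K a ω * (f ω : ℂ) / ((f ω + g ω : ℝ) : ℂ) - C ω / ((f ω + g ω : ℝ) : ℂ)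

end MissingFilter

end

/-! The proof is a saddle-point argument. The error `Δ(h; f, g)` is affine in `(f, g)` for fixed
`h`, the set `D` is convex, and the value of the extremal problem at a minimal pair is the smallest
error for that pair. A maximum of an infimum of affine functions on a convex set should give a
saddle point; the work lies in the fact that the minimizer and the space it ranges over both depend
on the densities.

For one pair with `f + g > 0` almost everywhere, `X ↦ X / (f + g)` identifies functions of finite
energy with the orthogonal complement of the observation space in `L²(f + g)`. Hence the weak
equation `B c = R a` says exactly that `C / (f + g)` is the part of `A f / (f + g)` orthogonal to
the observations, so (4) is a projection. Completing the square gives Pythagoras' theorem for the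
error (`IsInvBR.mse_eq`), and the error of (4) is the objective of the extremal problem
(`IsInvBR.mse_charFormula`).

Let `m` be the error of `h₀`, the function (4) for `(f₀, g₀)`, and let `(f, g) ∈ D` be arbitrary,
minimal or not. For `0 < t < 1` the mixture of the two pairs with weights `1 - t` and `t` lies in
`D` and inherits minimality from `(f₀, g₀)`, so its optimal `k` has error at most `m`. Affinity and
Pythagoras at `(f₀, g₀)` turn this into `(1 - t) (1/2π) ‖h₀ - k‖² + t Δ(k; f, g) ≤ t m`, the norm
being that of `L²(f₀ + g₀)`. Both terms are used (`exists_approx`): `Δ(k; f, g) ≤ m`, and `k → h₀`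
as `t → 0`. Along a subsequence the convergence is almost everywhere; Fatou's lemma gives `Δ(h₀; f,
g) ≤ m`, and a weak limit argument puts `h₀` in the observation space of `(f, g)` (`saddle_point`).
Both extremal properties follow from this saddle inequality and the optimality of `h₀` at `(f₀,
g₀)`. -/

namespace MissingFilter

open Filter Topology

/-! ### Closed spans in `L²` -/

section ClosedSpan

variable {μ : Measure ℝ}

/-- The classes in `L²(μ)` of the elements of `E`. -/
noncomputable def lpSpan (μ : Measure ℝ) (E : Set (ℝ → ℂ)) : Submodule ℂ (Lp ℂ 2 μ) :=
  Submodule.span ℂ {x | ∃ e ∈ E, x =ᵐ[μ] e}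

theorem memLp_of_mem_span {E : Set (ℝ → ℂ)} (hE : ∀ e ∈ E, MemLp e 2 μ) {p : ℝ → ℂ}
    (hp : p ∈ Submodule.span ℂ E) : MemLp p 2 μ := by
  induction hp using Submodule.span_induction with
  | mem x hx => exact hE x hx
  | zero => exact MemLp.zero
  | add x y _ _ hx hy => exact hx.add hy
  | smul c x _ hx => exact hx.const_smul c

theorem toLp_mem_lpSpan {E : Set (ℝ → ℂ)} (hE : ∀ e ∈ E, MemLp e 2 μ) {p : ℝ → ℂ}
    (hp : p ∈ Submodule.span ℂ E) (h : MemLp p 2 μ) : h.toLp p ∈ lpSpan μ E := by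
  induction hp using Submodule.span_induction with
  | mem x hx => exact Submodule.subset_span ⟨x, hx, h.coeFn_toLp⟩
  | zero => simp [MemLp.toLp_zero]
  | add x y hxE hyE hx hy =>
    have h1 := memLp_of_mem_span hE hxE
    have h2 := memLp_of_mem_span hE hyE
    have : h.toLp (x + y) = h1.toLp x + h2.toLp y := MemLp.toLp_add h1 h2
    rw [this]
    exact Submodule.add_mem _ (hx h1) (hy h2)
  | smul c x hxE hx =>
    have h1 := memLp_of_mem_span hE hxE
    have : h.toLp (c • x) = c • h1.toLp x := MemLp.toLp_const_smul c h1
    rw [this]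
    exact Submodule.smul_mem _ _ (hx h1)

theorem exists_mem_span_of_mem_lpSpan {E : Set (ℝ → ℂ)} {x : Lp ℂ 2 μ} (hx : x ∈ lpSpan μ E) :
    ∃ p ∈ Submodule.span ℂ E, x =ᵐ[μ] p := by
  induction hx using Submodule.span_induction with
  | mem x hx =>
    obtain ⟨e, he, h⟩ := hx
    exact ⟨e, Submodule.subset_span he, h⟩
  | zero => exact ⟨0, Submodule.zero_mem _, Lp.coeFn_zero _ _ _⟩
  | add x y _ _ hx hy =>
    obtain ⟨p, hp, h1⟩ := hx
    obtain ⟨q, hq, h2⟩ := hy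
    exact ⟨p + q, Submodule.add_mem _ hp hq, (Lp.coeFn_add x y).trans (h1.add h2)⟩
  | smul c x _ hx =>
    obtain ⟨p, hp, h1⟩ := hx
    exact ⟨c • p, Submodule.smul_mem _ c hp, (Lp.coeFn_smul c x).trans (h1.const_smul c)⟩

theorem inner_toLp_eq {F G : ℝ → ℂ} (hF : MemLp F 2 μ) (hG : MemLp G 2 μ) :
    inner ℂ (hG.toLp G) (hF.toLp F) = ∫ ω, F ω * conj (G ω) ∂μ := by
  rw [L2.inner_def]
  refine integral_congr_ae ?_
  filter_upwards [hF.coeFn_toLp, hG.coeFn_toLp] with ω h1 h2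
  rw [h1, h2, RCLike.inner_apply]

theorem toLp_mem_lpSpan_orthogonal_iff {E : Set (ℝ → ℂ)} (hE : ∀ e ∈ E, MemLp e 2 μ) {Y : ℝ → ℂ}
    (hY : MemLp Y 2 μ) :
    hY.toLp Y ∈ (lpSpan μ E)ᗮ ↔ ∀ e ∈ E, ∫ ω, Y ω * conj (e ω) ∂μ = 0 := by
  constructor
  · intro h e he
    rw [← inner_toLp_eq hY (hE e he)]
    exact (Submodule.mem_orthogonal _ _).1 h _ (Submodule.subset_span ⟨e, he, (hE e he).coeFn_toLp⟩)
  · intro h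
    rw [Submodule.mem_orthogonal]
    intro u hu
    induction hu using Submodule.span_induction with
    | mem x hx =>
      obtain ⟨e, he, hxe⟩ := hx
      have : x = (hE e he).toLp e := Lp.ext (hxe.trans (hE e he).coeFn_toLp.symm)
      rw [this, inner_toLp_eq]
      exact h e he
    | zero => exact inner_zero_left _
    | add x y _ _ hx hy => rw [inner_add_left, hx, hy, add_zero]
    | smul c x _ hx => rw [inner_smul_left, hx, mul_zero]

/-- Links the approximation form of the closed span, stated for functions, with the topological
closure of a subspace of `Lp`, where Hilbert space theory is available. -/
theorem toLp_mem_closure_iff {E : Set (ℝ → ℂ)} (hE : ∀ e ∈ E, MemLp e 2 μ) {h : ℝ → ℂ}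
    (hh : MemLp h 2 μ) :
    hh.toLp h ∈ (lpSpan μ E).topologicalClosure ↔
      ∀ δ : ℝ≥0∞, 0 < δ → ∃ p ∈ Submodule.span ℂ E, eLpNorm (h - p) 2 μ < δ := by
  rw [← SetLike.mem_coe, Submodule.topologicalClosure_coe, EMetric.mem_closure_iff]
  refine forall₂_congr fun δ _ => ⟨?_, ?_⟩
  · rintro ⟨x, hx, hd⟩
    obtain ⟨p, hp, hxp⟩ := exists_mem_span_of_mem_lpSpan hx
    refine ⟨p, hp, ?_⟩
    have hpm := memLp_of_mem_span hE hp
    have : x = hpm.toLp p := Lp.ext (hxp.trans hpm.coeFn_toLp.symm)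
    rwa [this, Lp.edist_toLp_toLp] at hd
  · rintro ⟨p, hp, hd⟩
    have hpm := memLp_of_mem_span hE hp
    exact ⟨hpm.toLp p, toLp_mem_lpSpan hE hp hpm, by rwa [Lp.edist_toLp_toLp]⟩

/-- The closure of a subspace is its double orthogonal complement. In this form membership is tested
by integrals, which suits both the weak equation for `C` and passage to weak limits. -/
theorem toLp_mem_closure_iff_forall_integral {E : Set (ℝ → ℂ)} (hE : ∀ e ∈ E, MemLp e 2 μ)
    {h : ℝ → ℂ} (hh : MemLp h 2 μ) :
    hh.toLp h ∈ (lpSpan μ E).topologicalClosure ↔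
      ∀ Y, MemLp Y 2 μ → (∀ e ∈ E, ∫ ω, Y ω * conj (e ω) ∂μ = 0) →
        ∫ ω, h ω * conj (Y ω) ∂μ = 0 := by
  rw [← Submodule.orthogonal_orthogonal_eq_closure, Submodule.mem_orthogonal]
  constructor
  · intro H Y hY hYE
    rw [← inner_toLp_eq hh hY]
    exact H _ ((toLp_mem_lpSpan_orthogonal_iff hE hY).2 hYE)
  · intro H u hu
    have hu' : (Lp.memLp u).toLp u = u := Lp.toLp_coeFn u _
    rw [← hu', inner_toLp_eq hh (Lp.memLp u)]
    refine H _ (Lp.memLp u) ((toLp_mem_lpSpan_orthogonal_iff hE (Lp.memLp u)).1 ?_)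
    rwa [hu']

/-- Existence of the orthogonal projection onto a closed span. -/
theorem exists_projection_closure {E : Set (ℝ → ℂ)} (hE : ∀ e ∈ E, MemLp e 2 μ) {F : ℝ → ℂ}
    (hF : MemLp F 2 μ) :
    ∃ (h : ℝ → ℂ) (hh : MemLp h 2 μ), hh.toLp h ∈ (lpSpan μ E).topologicalClosure ∧
      ∀ e ∈ E, ∫ ω, (F - h) ω * conj (e ω) ∂μ = 0 := by
  have : CompleteSpace (lpSpan μ E).topologicalClosure :=
    (Submodule.isClosed_topologicalClosure _).completeSpace_coe
  obtain ⟨y, hy, z, hz, hyz⟩ :=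
    (lpSpan μ E).topologicalClosure.exists_add_mem_mem_orthogonal (hF.toLp F)
  refine ⟨y, Lp.memLp y, by rwa [Lp.toLp_coeFn], ?_⟩
  rw [← toLp_mem_lpSpan_orthogonal_iff hE (hF.sub (Lp.memLp y)), MemLp.toLp_sub hF (Lp.memLp y),
    Lp.toLp_coeFn, hyz, add_sub_cancel_left]
  rwa [Submodule.orthogonal_closure] at hz

/-! ### Square integrals, Pythagoras and weak limits -/

theorem lintegral_enorm_sq_eq_ofReal {h : ℝ → ℂ} (hh : MemLp h 2 μ) :
    ∫⁻ ω, ‖h ω‖ₑ ^ 2 ∂μ = ENNReal.ofReal (∫ ω, ‖h ω‖ ^ 2 ∂μ) := by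
  rw [ofReal_integral_eq_lintegral_ofReal ((memLp_two_iff_integrable_sq_norm hh.1).1 hh)
    (Eventually.of_forall fun _ => by positivity)]
  refine lintegral_congr fun ω => ?_
  rw [ENNReal.ofReal_pow (norm_nonneg _), ofReal_norm]

theorem memLp_two_of_lintegral_lt_top {h : ℝ → ℂ} (hm : AEStronglyMeasurable h μ)
    (hh : ∫⁻ ω, ‖h ω‖ₑ ^ 2 ∂μ < ∞) : MemLp h 2 μ := by
  refine ⟨hm, ?_⟩
  rw [eLpNorm_lt_top_iff_lintegral_rpow_enorm_lt_top (by norm_num) (by norm_num)]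
  simpa using hh

theorem lintegral_enorm_sq_lt_top {h : ℝ → ℂ} (hh : MemLp h 2 μ) :
    ∫⁻ ω, ‖h ω‖ₑ ^ 2 ∂μ < ∞ := by
  rw [lintegral_enorm_sq_eq_ofReal hh]
  exact ENNReal.ofReal_lt_top

theorem eLpNorm_two_sq {h : ℝ → ℂ} : eLpNorm h 2 μ ^ 2 = ∫⁻ ω, ‖h ω‖ₑ ^ 2 ∂μ := by
  rw [eLpNorm_eq_lintegral_rpow_enorm_toReal (by norm_num) (by norm_num), ← ENNReal.rpow_natCast,
    ← ENNReal.rpow_mul]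
  norm_num

theorem integrable_mul_conj {F G : ℝ → ℂ} (hF : MemLp F 2 μ) (hG : MemLp G 2 μ) :
    Integrable (fun ω => F ω * conj (G ω)) μ :=
  MemLp.integrable_mul (p := 2) (q := 2) hF hG.star

/-- Pythagoras' theorem in `L²`. -/
theorem lintegral_enorm_add_sq_of_orthogonal {F G : ℝ → ℂ} (hF : MemLp F 2 μ) (hG : MemLp G 2 μ)
    (hFG : ∫ ω, F ω * conj (G ω) ∂μ = 0) :
    ∫⁻ ω, ‖F ω + G ω‖ₑ ^ 2 ∂μ = (∫⁻ ω, ‖F ω‖ₑ ^ 2 ∂μ) + ∫⁻ ω, ‖G ω‖ₑ ^ 2 ∂μ := by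
  have hFi := (memLp_two_iff_integrable_sq_norm hF.1).1 hF
  have hGi := (memLp_two_iff_integrable_sq_norm hG.1).1 hG
  have hi := (integrable_mul_conj hF hG)
  have h1 := lintegral_enorm_sq_eq_ofReal (hF.add hG)
  simp only [Pi.add_apply] at h1
  rw [h1, lintegral_enorm_sq_eq_ofReal hF, lintegral_enorm_sq_eq_ofReal hG,
    ← ENNReal.ofReal_add (integral_nonneg fun _ => by positivity)
      (integral_nonneg fun _ => by positivity)]
  congr 1
  have h2 : ∀ ω, ‖F ω + G ω‖ ^ 2 = ‖F ω‖ ^ 2 + ‖G ω‖ ^ 2 + 2 * (F ω * conj (G ω)).re := by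
    intro ω
    rw [← Complex.normSq_eq_norm_sq, ← Complex.normSq_eq_norm_sq, ← Complex.normSq_eq_norm_sq,
      Complex.normSq_add]
  simp only [h2]
  have hre : ∫ ω, (F ω * conj (G ω)).re ∂μ = 0 := by
    have := integral_re hi
    simp only [RCLike.re_to_complex] at this
    rw [this, hFG, Complex.zero_re]
  have hi2 : Integrable (fun ω => 2 * (F ω * conj (G ω)).re) μ := hi.re.const_mul 2
  have hi1 : Integrable (fun ω => ‖F ω‖ ^ 2 + ‖G ω‖ ^ 2) μ := hFi.add hGi
  rw [integral_add hi1 hi2, integral_add hFi hGi, integral_const_mul, hre, mul_zero,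
    add_zero]

/-- Weak convergence in `L²`: if `k n → h` almost everywhere with bounded `L²` norms, then
orthogonality to a fixed function passes to the limit. -/
theorem integral_mul_conj_eq_zero_of_tendsto_ae {k : ℕ → ℝ → ℂ} {h Y : ℝ → ℂ} {M : ℝ≥0∞}
    (hM : M ≠ ∞) (hk : ∀ n, MemLp (k n) 2 μ) (hh : MemLp h 2 μ) (hY : MemLp Y 2 μ)
    (hb : ∀ n, ∫⁻ ω, ‖k n ω - h ω‖ₑ ^ 2 ∂μ ≤ M)
    (hlim : ∀ᵐ ω ∂μ, Tendsto (fun n => k n ω) atTop (𝓝 (h ω)))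
    (h0 : ∀ n, ∫ ω, k n ω * conj (Y ω) ∂μ = 0) :
    ∫ ω, h ω * conj (Y ω) ∂μ = 0 := by
  have hYi := (memLp_two_iff_integrable_sq_norm hY.1).1 hY
  set M' := M.toReal
  have hb' : ∀ n, ∫ ω, ‖k n ω - h ω‖ ^ 2 ∂μ ≤ M' := by
    intro n
    have h1 := lintegral_enorm_sq_eq_ofReal ((hk n).sub hh)
    simp only [Pi.sub_apply] at h1
    have h2 := hb n
    rw [h1] at h2
    exact (ENNReal.ofReal_le_iff_le_toReal hM).1 h2
  have hM0 : 0 ≤ M' := ENNReal.toReal_nonneg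
  have hri : ∀ n, Integrable (fun ω => ‖k n ω - h ω‖ ^ 2) μ := fun n =>
    (memLp_two_iff_integrable_sq_norm ((hk n).sub hh).1).1 ((hk n).sub hh)
  -- the truncated products tend to zero by dominated convergence
  have key : ∀ c : ℝ, 0 < c → ‖∫ ω, h ω * conj (Y ω) ∂μ‖ ≤ c⁻¹ * M' := by
    intro c hc
    -- Where `‖k n - h‖ ≤ c ‖Y‖`, the product `‖k n - h‖ ‖Y‖` is dominated by `c ‖Y‖²`; elsewhere it
    -- is at most `c⁻¹ ‖k n - h‖²`, whose integral is at most `c⁻¹ M'` uniformly in `n`. Letting `n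
    -- → ∞` and then `c → ∞` removes both contributions.
    set m : ℕ → ℝ → ℝ := fun n ω => min (‖k n ω - h ω‖ * ‖Y ω‖) (c * ‖Y ω‖ ^ 2)
    have hm_meas : ∀ n, AEStronglyMeasurable (m n) μ := fun n =>
      ((((hk n).sub hh).1.norm.mul hY.1.norm)).inf (hY.1.norm.pow 2 |>.const_mul c)
    have hm_bd : ∀ n, ∀ᵐ ω ∂μ, ‖m n ω‖ ≤ c * ‖Y ω‖ ^ 2 := by
      intro n
      refine Eventually.of_forall fun ω => ?_
      rw [Real.norm_of_nonneg (le_min (by positivity) (by positivity))]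
      exact min_le_right _ _
    have hm_int : ∀ n, Integrable (m n) μ := fun n => (hYi.const_mul c).mono' (hm_meas n) (hm_bd n)
    have hm_lim : Tendsto (fun n => ∫ ω, m n ω ∂μ) atTop (𝓝 (∫ _, (0 : ℝ) ∂μ)) := by
      refine tendsto_integral_of_dominated_convergence _ hm_meas (hYi.const_mul c) hm_bd ?_
      filter_upwards [hlim] with ω hω
      have h1 : Tendsto (fun n => ‖k n ω - h ω‖ * ‖Y ω‖) atTop (𝓝 0) := by
        have := ((hω.sub_const (h ω)).norm).mul_const ‖Y ω‖
        simpa using this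
      have h2 := h1.min (tendsto_const_nhds (x := c * ‖Y ω‖ ^ 2))
      rwa [min_eq_left (by positivity)] at h2
    rw [integral_zero] at hm_lim
    have hle : ∀ n, ‖∫ ω, h ω * conj (Y ω) ∂μ‖ ≤ (∫ ω, m n ω ∂μ) + c⁻¹ * M' := by
      intro n
      have h1 : ∫ ω, h ω * conj (Y ω) ∂μ = - ∫ ω, (k n ω - h ω) * conj (Y ω) ∂μ := by
        simp only [sub_mul]
        rw [integral_sub (integrable_mul_conj (hk n) hY) (integrable_mul_conj hh hY), h0 n]
        simp
      rw [h1, norm_neg]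
      calc ‖∫ ω, (k n ω - h ω) * conj (Y ω) ∂μ‖
          ≤ ∫ ω, (m n ω + c⁻¹ * ‖k n ω - h ω‖ ^ 2) ∂μ := by
            refine norm_integral_le_of_norm_le ((hm_int n).add ((hri n).const_mul _))
              (Eventually.of_forall fun ω => ?_)
            rw [norm_mul, RCLike.norm_conj]
            rcases le_total ‖k n ω - h ω‖ (c * ‖Y ω‖) with hle | hle
            · have : m n ω = ‖k n ω - h ω‖ * ‖Y ω‖ := min_eq_left (by nlinarith [norm_nonneg (Y ω)])
              rw [this]
              have : 0 ≤ c⁻¹ * ‖k n ω - h ω‖ ^ 2 := by positivity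
              linarith
            · have h3 : 0 ≤ m n ω := le_min (by positivity) (by positivity)
              have h4 : ‖k n ω - h ω‖ * ‖Y ω‖ ≤ c⁻¹ * ‖k n ω - h ω‖ ^ 2 := by
                rw [← div_eq_inv_mul, le_div_iff₀ hc]
                nlinarith [norm_nonneg (k n ω - h ω)]
              linarith
        _ = (∫ ω, m n ω ∂μ) + c⁻¹ * ∫ ω, ‖k n ω - h ω‖ ^ 2 ∂μ := by
            rw [integral_add (hm_int n) ((hri n).const_mul _), integral_const_mul]
        _ ≤ _ := by gcongr; exact hb' n
    have := ge_of_tendsto' (hm_lim.add_const (c⁻¹ * M')) hle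
    simpa using this
  have hlim0 : Tendsto (fun c : ℝ => c⁻¹ * M') atTop (𝓝 0) := by
    simpa using tendsto_inv_atTop_zero.mul_const M'
  have := ge_of_tendsto hlim0 ((eventually_gt_atTop 0).mono key)
  exact norm_le_zero_iff.1 this

end ClosedSpan

/-! ### Functions of exponential type and the minimality condition -/

/-- The integration interval is bounded, so the exponentials and their derivatives are locally
uniformly bounded in `z` and one may differentiate under the integral: `γ` extends to an entire
function. -/
theorem differentiable_integral_exp {τ : ℝ} {α : ℝ → ℂ} (hα : IntegrableOn α (Icc 0 τ)) :
    Differentiable ℂ fun z : ℂ => ∫ t in Icc 0 τ, α t * Complex.exp (Complex.I * t * z) := by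
  intro z₀
  have hexp : ∀ z : ℂ, Continuous fun t : ℝ => Complex.exp (Complex.I * t * z) := fun z => by
    fun_prop
  have hbound : ∀ t ∈ Icc (0 : ℝ) τ, ∀ z ∈ Metric.ball z₀ 1,
      ‖Complex.exp (Complex.I * t * z)‖ ≤ Real.exp (τ * (‖z₀‖ + 1)) := by
    intro t ht z hz
    rw [Complex.norm_exp]
    refine Real.exp_le_exp.2 ((Complex.re_le_norm _).trans ?_)
    have hz' : ‖z‖ ≤ ‖z₀‖ + 1 := by
      have := norm_sub_norm_le z z₀
      rw [Metric.mem_ball, dist_eq_norm] at hz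
      linarith
    rw [norm_mul, norm_mul, Complex.norm_I, one_mul, Complex.norm_real, Real.norm_of_nonneg ht.1]
    exact mul_le_mul ht.2 hz' (norm_nonneg _) (ht.1.trans ht.2)
  have hmeas : ∀ z : ℂ, AEStronglyMeasurable (fun t : ℝ => α t * Complex.exp (Complex.I * t * z))
      (volume.restrict (Icc 0 τ)) := fun z => hα.1.mul (hexp z).aestronglyMeasurable
  refine (hasDerivAt_integral_of_dominated_loc_of_deriv_le (Metric.ball_mem_nhds z₀ one_pos)
    (F' := fun z t => α t * (Complex.exp (Complex.I * t * z) * (Complex.I * t)))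
    (bound := fun t => ‖α t‖ * (Real.exp (τ * (‖z₀‖ + 1)) * τ))
    (Eventually.of_forall hmeas) ?_ ?_ ?_ ?_ ?_).2.differentiableAt
  · refine (hα.norm.mul_const (Real.exp (τ * (‖z₀‖ + 1)))).mono' (hmeas z₀) ?_
    filter_upwards [ae_restrict_mem measurableSet_Icc] with t ht
    rw [norm_mul]
    gcongr
    exact hbound t ht z₀ (Metric.mem_ball_self one_pos)
  · exact hα.1.mul ((hexp z₀).mul (by fun_prop)).aestronglyMeasurable
  · filter_upwards [ae_restrict_mem measurableSet_Icc] with t ht z hz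
    rw [norm_mul, norm_mul, norm_mul, Complex.norm_I, one_mul, Complex.norm_real,
      Real.norm_of_nonneg ht.1]
    exact mul_le_mul_of_nonneg_left (mul_le_mul (hbound t ht z hz) ht.2 ht.1 (Real.exp_nonneg _))
      (norm_nonneg _)
  · exact hα.norm.mul_const _
  · refine Eventually.of_forall fun t z _ => ?_
    have h1 : HasDerivAt (fun z : ℂ => Complex.I * t * z) (Complex.I * t) z := by
      simpa using (hasDerivAt_id z).const_mul (Complex.I * (t : ℂ))
    exact (h1.cexp).const_mul (α t)

/-- The zeros of a real-analytic function that is not identically zero are isolated, hence form a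
null set. -/
theorem ae_integral_expi_ne_zero {τ : ℝ} {α : ℝ → ℂ} (hα : IntegrableOn α (Icc 0 τ))
    (hne : ∃ ω, (∫ t in Icc 0 τ, α t * expi t ω) ≠ 0) :
    ∀ᵐ ω : ℝ, (∫ t in Icc 0 τ, α t * expi t ω) ≠ 0 := by
  obtain ⟨ω₀, hω₀⟩ := hne
  have han : AnalyticOnNhd ℝ (fun ω : ℝ => ∫ t in Icc 0 τ, α t * expi t ω) univ := by
    intro ω _
    have h1 := ((differentiable_integral_exp hα).analyticAt (ω : ℂ)).restrictScalars (𝕜 := ℝ)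
    exact h1.comp (Complex.ofRealCLM.analyticAt ω)
  have h2 := han.preimage_zero_mem_codiscrete (x := ω₀) hω₀
  have h3 := ae_restrict_le_codiscreteWithin (α := ℝ) (μ := volume) MeasurableSet.univ h2
  rw [Measure.restrict_univ] at h3
  exact h3

/-- Where `f + g` vanishes and `γ ≠ 0` the quotient is `∞`; a finite integral allows this only on a
null set, and `γ ≠ 0` almost everywhere. -/
theorem Minimality.ae_pos {f g : ℝ → ℝ} (hf : IsSpectralDensity f) (hg : IsSpectralDensity g)
    (h : Minimality f g) : ∀ᵐ ω, 0 < f ω + g ω := by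
  obtain ⟨τ, α, hα, hne, hfin⟩ := h
  have hcont : Continuous fun ω : ℝ => ∫ t in Icc 0 τ, α t * expi t ω :=
    (differentiable_integral_exp hα).continuous.comp Complex.continuous_ofReal
  have hmeas : AEMeasurable fun ω =>
      ‖∫ t in Icc 0 τ, α t * expi t ω‖ₑ ^ 2 / ENNReal.ofReal (f ω + g ω) :=
    (hcont.enorm.measurable.pow_const 2).aemeasurable.div (hf.2.add hg.2).1.aemeasurable.ennreal_ofReal
  filter_upwards [ae_lt_top' hmeas hfin.ne, ae_integral_expi_ne_zero hα hne] with ω h1 h2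
  by_contra hle
  rw [ENNReal.ofReal_of_nonpos (not_lt.1 hle), ENNReal.div_zero] at h1
  · exact lt_irrefl _ h1
  · simpa using h2

/-- The minimality condition passes to pairs with a larger sum, up to a constant factor. -/
theorem Minimality.mono {f g f' g' : ℝ → ℝ} (h : Minimality f g) {r : ℝ} (hr : 0 < r)
    (hle : ∀ᵐ ω, r * (f ω + g ω) ≤ f' ω + g' ω) : Minimality f' g' := by
  obtain ⟨τ, α, hα, hne, hfin⟩ := h
  refine ⟨τ, α, hα, hne, ?_⟩
  have hr' : ENNReal.ofReal r ≠ 0 := by simpa using hr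
  calc ∫⁻ ω, ‖∫ t in Icc 0 τ, α t * expi t ω‖ₑ ^ 2 / ENNReal.ofReal (f' ω + g' ω)
      ≤ ∫⁻ ω, (ENNReal.ofReal r)⁻¹ *
          (‖∫ t in Icc 0 τ, α t * expi t ω‖ₑ ^ 2 / ENNReal.ofReal (f ω + g ω)) := by
        refine lintegral_mono_ae (hle.mono fun ω hω => ?_)
        rw [mul_comm, div_eq_mul_inv _ (ENNReal.ofReal (f ω + g ω)), mul_assoc,
          ← ENNReal.mul_inv (Or.inr ENNReal.ofReal_ne_top) (Or.inr hr'), ← div_eq_mul_inv,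
          mul_comm (ENNReal.ofReal (f ω + g ω)), ← ENNReal.ofReal_mul hr.le]
        exact ENNReal.div_le_div_left (ENNReal.ofReal_le_ofReal hω) _
    _ < ∞ := by
        rw [lintegral_const_mul' _ _ (by simpa using hr)]
        exact ENNReal.mul_lt_top (by simpa using hr) hfin

section Filtering

variable {s : ℕ} {N K : ℕ → ℝ} {a : ℝ → ℂ} {f g : ℝ → ℝ}

/-! ### Time sets and symbols -/

theorem gapStart_nonneg (hN : ∀ l, 0 ≤ N l) (hK : ∀ l, 0 ≤ K l) (l : ℕ) : 0 ≤ gapStart N K l :=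
  Finset.sum_nonneg fun k _ => add_nonneg (hN k) (hK k)

theorem gapSet_subset_Iic (hN : ∀ l, 0 ≤ N l) (hK : ∀ l, 0 ≤ K l) : gapSet s N K ⊆ Iic 0 := by
  simp only [gapSet, iUnion_subset_iff]
  intro l _ t ht
  have := gapStart_nonneg hN hK l
  exact ht.2.trans (by linarith)

theorem measurableSet_gapSet : MeasurableSet (gapSet s N K) :=
  Finset.measurableSet_biUnion _ fun _ _ => measurableSet_Icc

theorem measurableSet_gapSetPos : MeasurableSet (gapSetPos s N K) :=
  Finset.measurableSet_biUnion _ fun _ _ => measurableSet_Icc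

theorem measurableSet_weightSet : MeasurableSet (weightSet s N K) :=
  measurableSet_Ici.diff measurableSet_gapSetPos

theorem notMem_timeSet_iff {t : ℝ} : t ∉ timeSet s N K ↔ t ∈ obsTimes s N K := by
  simp only [timeSet, obsTimes, mem_union, mem_Ici, Set.mem_sdiff, mem_Iio]
  grind

theorem weightSet_diff_gapSet_subset : weightSet s N K \ gapSet s N K ⊆ timeSet s N K :=
  fun _ ht => Or.inr ht.1.1

/-- The gaps lie in `t ≤ 0` and the weight in `t ≥ 0`, so they share at most the point `0`; the
extension of `a` by zero therefore has the same transform `A`. -/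
theorem weightSet_diff_gapSet_ae_eq (hN : ∀ l, 0 ≤ N l) (hK : ∀ l, 0 ≤ K l) :
    (weightSet s N K \ gapSet s N K : Set ℝ) =ᵐ[volume] weightSet s N K := by
  have h0 : ∀ᵐ t : ℝ, t ≠ 0 := by simp [ae_iff]
  filter_upwards [h0] with t ht
  refine propext ⟨fun h => h.1, fun h => ⟨h, fun h' => ht ?_⟩⟩
  exact le_antisymm (gapSet_subset_Iic hN hK h') h.1

theorem norm_expi (t ω : ℝ) : ‖expi t ω‖ = 1 := by
  have : Complex.I * t * ω = ((t * ω : ℝ) : ℂ) * Complex.I := by push_cast; ring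
  rw [expi, this, Complex.norm_exp_ofReal_mul_I]

theorem continuous_expi (t : ℝ) : Continuous (expi t) := by
  unfold expi; fun_prop

theorem conj_expi (t ω : ℝ) : conj (expi t ω) = expi (-t) ω := by
  rw [expi, expi, ← Complex.exp_conj]
  congr 1
  simp

theorem expi_add (t u ω : ℝ) : expi (t + u) ω = expi t ω * expi u ω := by
  rw [expi, expi, expi, ← Complex.exp_add]
  congr 1
  push_cast; ring

theorem norm_weightSymbol_le (ω : ℝ) :
    ‖weightSymbol s N K a ω‖ ≤ ∫ t in weightSet s N K, ‖a t‖ := by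
  refine (norm_integral_le_integral_norm _).trans (le_of_eq ?_)
  simp [norm_expi]

theorem continuous_weightSymbol (ha : IntegrableOn a (weightSet s N K)) :
    Continuous (weightSymbol s N K a) := by
  refine continuous_of_dominated (bound := fun t => ‖a t‖) (fun ω => ?_) (fun ω => ?_) ha.norm ?_
  · refine ha.1.mul (Continuous.aestronglyMeasurable ?_)
    unfold expi; fun_prop
  · exact Eventually.of_forall fun t => by simp [norm_expi]
  · exact Eventually.of_forall fun t => continuous_const.mul (continuous_expi _)

theorem integrableOn_extWeight (ha : IntegrableOn a (weightSet s N K)) :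
    IntegrableOn (extWeight s N K a) (timeSet s N K) := by
  refine Integrable.integrableOn ?_
  rw [extWeight, integrable_indicator_iff (measurableSet_weightSet.diff measurableSet_gapSet)]
  exact ha.mono_set sdiff_subset

theorem integral_extWeight_mul_expi (hN : ∀ l, 0 ≤ N l) (hK : ∀ l, 0 ≤ K l) (ω : ℝ) :
    ∫ t in timeSet s N K, extWeight s N K a t * expi (-t) ω = weightSymbol s N K a ω := by
  have hm : MeasurableSet (weightSet s N K \ gapSet s N K) :=
    measurableSet_weightSet.diff measurableSet_gapSet
  have h1 : (fun t => extWeight s N K a t * expi (-t) ω) =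
      (weightSet s N K \ gapSet s N K).indicator fun t => a t * expi (-t) ω := by
    ext t
    rw [extWeight, indicator_mul_left]
  rw [h1, setIntegral_indicator hm, inter_eq_self_of_subset_right weightSet_diff_gapSet_subset,
    weightSymbol]
  exact setIntegral_congr_set (weightSet_diff_gapSet_ae_eq hN hK)

/-! ### The measure `(f + g) dω` -/

theorem aemeasurable_sum (hf : IsSpectralDensity f) (hg : IsSpectralDensity g) :
    AEMeasurable (fun ω => f ω + g ω) := (hf.2.add hg.2).1.aemeasurable

theorem IsSpectralDensity.isFiniteMeasure (hf : IsSpectralDensity f) (hg : IsSpectralDensity g) :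
    IsFiniteMeasure (sumMeasure f g) :=
  isFiniteMeasure_withDensity_ofReal (hf.2.add hg.2).2

theorem sumMeasure_absolutelyContinuous : sumMeasure f g ≪ volume :=
  withDensity_absolutelyContinuous _ _

theorem absolutelyContinuous_sumMeasure (hf : IsSpectralDensity f) (hg : IsSpectralDensity g)
    (hw : ∀ᵐ ω, 0 < f ω + g ω) : volume ≪ sumMeasure f g :=
  withDensity_absolutelyContinuous' (aemeasurable_sum hf hg).ennreal_ofReal
    (hw.mono fun ω hω => by simpa using hω)

theorem lintegral_sumMeasure (hf : IsSpectralDensity f) (hg : IsSpectralDensity g) (φ : ℝ → ℝ≥0∞) :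
    ∫⁻ ω, φ ω ∂sumMeasure f g = ∫⁻ ω, ENNReal.ofReal (f ω + g ω) * φ ω := by
  rw [sumMeasure, lintegral_withDensity_eq_lintegral_mul_non_measurable₀ _
    (aemeasurable_sum hf hg).ennreal_ofReal (Eventually.of_forall fun _ => by simp)]
  rfl

theorem integral_sumMeasure (hf : IsSpectralDensity f) (hg : IsSpectralDensity g) (φ : ℝ → ℂ) :
    ∫ ω, φ ω ∂sumMeasure f g = ∫ ω, ((f ω + g ω : ℝ) : ℂ) * φ ω := by
  rw [sumMeasure, integral_withDensity_eq_integral_toReal_smul₀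
    (aemeasurable_sum hf hg).ennreal_ofReal (Eventually.of_forall fun _ => by simp)]
  refine integral_congr_ae ?_
  filter_upwards [hf.1, hg.1] with ω h1 h2
  rw [ENNReal.toReal_ofReal (by linarith), Complex.real_smul]

theorem memLp_expi [IsFiniteMeasure (sumMeasure f g)] :
    ∀ e ∈ expi '' obsTimes s N K, MemLp e 2 (sumMeasure f g) := by
  rintro _ ⟨t, _, rfl⟩
  exact MemLp.of_bound (continuous_expi t).aestronglyMeasurable 1
    (Eventually.of_forall fun ω => (norm_expi t ω).le)

theorem mem_obsSpace_iff (hf : IsSpectralDensity f) (hg : IsSpectralDensity g) {h : ℝ → ℂ} :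
    h ∈ obsSpace s N K f g ↔ MemLp h 2 (sumMeasure f g) ∧
      ∀ Y, MemLp Y 2 (sumMeasure f g) →
        (∀ e ∈ expi '' obsTimes s N K, ∫ ω, Y ω * conj (e ω) ∂sumMeasure f g = 0) →
        ∫ ω, h ω * conj (Y ω) ∂sumMeasure f g = 0 := by
  have := hf.isFiniteMeasure hg
  refine and_congr_right fun hh => ?_
  rw [← toLp_mem_closure_iff_forall_integral memLp_expi hh, toLp_mem_closure_iff memLp_expi hh]

theorem exists_projection_obsSpace (hf : IsSpectralDensity f) (hg : IsSpectralDensity g)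
    {F : ℝ → ℂ} (hF : MemLp F 2 (sumMeasure f g)) :
    ∃ h ∈ obsSpace s N K f g,
      ∀ e ∈ expi '' obsTimes s N K, ∫ ω, (F ω - h ω) * conj (e ω) ∂sumMeasure f g = 0 := by
  have := hf.isFiniteMeasure hg
  obtain ⟨h, hh, h1, h2⟩ := exists_projection_closure (memLp_expi (s := s) (N := N) (K := K)) hF
  exact ⟨h, ⟨hh, (toLp_mem_closure_iff memLp_expi hh).1 h1⟩, h2⟩

/-- The observation spaces decrease when the density grows, up to a constant factor. -/
theorem obsSpace_mono {f' g' : ℝ → ℝ} {c : ℝ} (hc : 0 < c)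
    (hle : ∀ᵐ ω, c * (f ω + g ω) ≤ f' ω + g' ω) :
    obsSpace s N K f' g' ⊆ obsSpace s N K f g := by
  -- Comparison of the densities is comparison of the measures, so approximation in the larger `L²`
  -- norm controls the smaller one up to the factor `r`.
  have hμ : sumMeasure f g ≤ (ENNReal.ofReal c)⁻¹ • sumMeasure f' g' := by
    rw [sumMeasure, sumMeasure, ← withDensity_smul' _ _ (by simpa using hc)]
    refine withDensity_mono (hle.mono fun ω hω => ?_)
    have hc' : ENNReal.ofReal c ≠ 0 := by simpa using hc
    rw [Pi.smul_apply, smul_eq_mul, ← ENNReal.div_eq_inv_mul,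
      ENNReal.le_div_iff_mul_le (Or.inl hc') (Or.inl ENNReal.ofReal_ne_top), mul_comm,
      ← ENNReal.ofReal_mul hc.le]
    exact ENNReal.ofReal_le_ofReal hω
  have hc' : (ENNReal.ofReal c)⁻¹ ≠ ∞ := by simpa using hc
  rintro h ⟨h1, h2⟩
  refine ⟨h1.of_measure_le_smul hc' hμ, fun δ hδ => ?_⟩
  set r : ℝ≥0∞ := ((ENNReal.ofReal c)⁻¹) ^ (1 / (2 : ℝ≥0∞).toReal) with hr
  have hr0 : r ≠ 0 := by
    rw [hr, ← pos_iff_ne_zero]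
    exact ENNReal.rpow_pos (by simp) hc'
  have hrt : r ≠ ∞ := ENNReal.rpow_ne_top_of_nonneg (by positivity) hc'
  obtain ⟨p, hp, hlt⟩ := h2 (δ / r) (ENNReal.div_pos hδ.ne' hrt)
  refine ⟨p, hp, ?_⟩
  calc eLpNorm (h - p) 2 (sumMeasure f g)
      ≤ eLpNorm (h - p) 2 ((ENNReal.ofReal c)⁻¹ • sumMeasure f' g') := eLpNorm_mono_measure _ hμ
    _ = r * eLpNorm (h - p) 2 (sumMeasure f' g') := by
        rw [eLpNorm_smul_measure_of_ne_top (by norm_num), smul_eq_mul, hr]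
        norm_num
    _ < r * (δ / r) := (ENNReal.mul_lt_mul_iff_right hr0 hrt).2 hlt
    _ = δ := ENNReal.mul_div_cancel hr0 hrt

/-! ### Functions of finite energy -/

/-- Division by the density `f + g`. -/
noncomputable def divSum (f g : ℝ → ℝ) (X : ℝ → ℂ) (ω : ℝ) : ℂ := X ω / ((f ω + g ω : ℝ) : ℂ)

/-- The spectral characteristic `A f / (f + g)` of the estimate from complete observations. -/
noncomputable def wiener (s : ℕ) (N K : ℕ → ℝ) (a : ℝ → ℂ) (f g : ℝ → ℝ) (ω : ℝ) : ℂ :=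
  weightSymbol s N K a ω * ((f ω / (f ω + g ω) : ℝ) : ℂ)

theorem charFormula_eq (C : ℝ → ℂ) (ω : ℝ) :
    charFormula s N K a f g C ω = wiener s N K a f g ω - divSum f g C ω := by
  rw [charFormula, wiener, divSum]
  push_cast
  ring

theorem aestronglyMeasurable_wiener (ha : IntegrableOn a (weightSet s N K))
    (hf : IsSpectralDensity f) (hg : IsSpectralDensity g) :
    AEStronglyMeasurable (wiener s N K a f g) :=
  (continuous_weightSymbol ha).aestronglyMeasurable.mul
    (Complex.measurable_ofReal.comp_aemeasurable
      (hf.2.1.aemeasurable.div (aemeasurable_sum hf hg))).aestronglyMeasurable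

theorem memLp_wiener (ha : IntegrableOn a (weightSet s N K)) (hf : IsSpectralDensity f)
    (hg : IsSpectralDensity g) : MemLp (wiener s N K a f g) 2 (sumMeasure f g) := by
  have := hf.isFiniteMeasure hg
  refine MemLp.of_bound ((aestronglyMeasurable_wiener ha hf hg).mono_ac
    sumMeasure_absolutelyContinuous) (∫ t in weightSet s N K, ‖a t‖) ?_
  refine sumMeasure_absolutelyContinuous.ae_le ?_
  filter_upwards [hf.1, hg.1] with ω h1 h2
  rw [wiener, norm_mul, Complex.norm_real, Real.norm_of_nonneg (by positivity)]
  exact (mul_le_of_le_one_right (norm_nonneg _)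
    (div_le_one_of_le₀ (by linarith) (by linarith))).trans (norm_weightSymbol_le ω)

/-- Division by `f + g` is an isometry from the energy norm to the norm of `L²(f + g)`. -/
theorem lintegral_divSum (hf : IsSpectralDensity f) (hg : IsSpectralDensity g)
    (hw : ∀ᵐ ω, 0 < f ω + g ω) (X : ℝ → ℂ) :
    ∫⁻ ω, ‖divSum f g X ω‖ₑ ^ 2 ∂sumMeasure f g =
      ∫⁻ ω, ‖X ω‖ₑ ^ 2 / ENNReal.ofReal (f ω + g ω) := by
  rw [lintegral_sumMeasure hf hg]
  refine lintegral_congr_ae (hw.mono fun ω hω => ?_)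
  have h1 : ‖divSum f g X ω‖ₑ = ‖X ω‖ₑ / ENNReal.ofReal (f ω + g ω) := by
    rw [divSum, ← ofReal_norm, ← ofReal_norm, norm_div, Complex.norm_real,
      Real.norm_of_nonneg hω.le, ENNReal.ofReal_div_of_pos hω]
  have h2 : ENNReal.ofReal (f ω + g ω) ≠ 0 := by simpa using hω
  dsimp only
  rw [h1, ENNReal.div_eq_inv_mul, ENNReal.div_eq_inv_mul, mul_pow, ← mul_assoc, sq, ← mul_assoc,
    ENNReal.mul_inv_cancel h2 ENNReal.ofReal_ne_top, one_mul]

theorem integral_divSum (hf : IsSpectralDensity f) (hg : IsSpectralDensity g)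
    (hw : ∀ᵐ ω, 0 < f ω + g ω) (X φ : ℝ → ℂ) :
    ∫ ω, divSum f g X ω * φ ω ∂sumMeasure f g = ∫ ω, X ω * φ ω := by
  rw [integral_sumMeasure hf hg]
  refine integral_congr_ae (hw.mono fun ω hω => ?_)
  have h2 : ((f ω + g ω : ℝ) : ℂ) ≠ 0 := by exact_mod_cast hω.ne'
  simp only [divSum]
  field_simp

theorem IsSymbolOn.memLp (hf : IsSpectralDensity f) (hg : IsSpectralDensity g)
    (hw : ∀ᵐ ω, 0 < f ω + g ω) {X : ℝ → ℂ} (hX : IsSymbolOn s N K f g X) :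
    MemLp (divSum f g X) 2 (sumMeasure f g) := by
  refine memLp_two_of_lintegral_lt_top ?_ ((lintegral_divSum hf hg hw X).trans_lt hX.2.1)
  exact (hX.1.aemeasurable.div (Complex.measurable_ofReal.comp_aemeasurable
    (aemeasurable_sum hf hg))).aestronglyMeasurable.mono_ac sumMeasure_absolutelyContinuous

/-- The weight cancels the division, so the integral is the Fourier coefficient of `X` at an
observation time, which vanishes since `x` lives on `T`. The converse is `isSymbolOn_mul`. -/
theorem IsSymbolOn.orthogonal (hf : IsSpectralDensity f) (hg : IsSpectralDensity g)
    (hw : ∀ᵐ ω, 0 < f ω + g ω) {X : ℝ → ℂ} (hX : IsSymbolOn s N K f g X) :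
    ∀ e ∈ expi '' obsTimes s N K, ∫ ω, divSum f g X ω * conj (e ω) ∂sumMeasure f g = 0 := by
  rintro _ ⟨t, ht, rfl⟩
  have h1 := hX.2.2 t (notMem_timeSet_iff.2 ht)
  rw [integral_divSum hf hg hw]
  simp only [conj_expi]
  refine (mul_eq_zero.1 h1).resolve_left ?_
  simp [Real.pi_ne_zero]

/-- A function of `L²(f + g)` orthogonal to the observations gives a function of finite energy. -/
theorem isSymbolOn_mul (hf : IsSpectralDensity f) (hg : IsSpectralDensity g)
    (hw : ∀ᵐ ω, 0 < f ω + g ω) {Z : ℝ → ℂ} (hZ : MemLp Z 2 (sumMeasure f g))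
    (h0 : ∀ e ∈ expi '' obsTimes s N K, ∫ ω, Z ω * conj (e ω) ∂sumMeasure f g = 0) :
    IsSymbolOn s N K f g (fun ω => ((f ω + g ω : ℝ) : ℂ) * Z ω) := by
  have hd : divSum f g (fun ω => ((f ω + g ω : ℝ) : ℂ) * Z ω) =ᵐ[volume] Z := hw.mono fun ω hω => by
    have h2 : ((f ω + g ω : ℝ) : ℂ) ≠ 0 := by exact_mod_cast hω.ne'
    simp only [divSum]
    field_simp
  refine ⟨?_, ?_, ?_⟩
  · exact (Complex.measurable_ofReal.comp_aemeasurable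
      (aemeasurable_sum hf hg)).aestronglyMeasurable.mul
      (hZ.1.mono_ac (absolutelyContinuous_sumMeasure hf hg hw))
  · rw [← lintegral_divSum hf hg hw]
    refine lt_of_eq_of_lt (lintegral_congr_ae ?_) (lintegral_enorm_sq_lt_top hZ)
    filter_upwards [sumMeasure_absolutelyContinuous.ae_le hd] with ω hω
    rw [hω]
  · intro t ht
    have := h0 _ ⟨t, notMem_timeSet_iff.1 ht, rfl⟩
    rw [integral_sumMeasure hf hg] at this
    simp only [conj_expi, ← mul_assoc] at this
    rw [this, mul_zero]

theorem pairB_eq (hf : IsSpectralDensity f) (hg : IsSpectralDensity g)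
    (hw : ∀ᵐ ω, 0 < f ω + g ω) (X Y : ℝ → ℂ) :
    pairB f g X Y = 1 / (2 * Real.pi) *
      ∫ ω, divSum f g X ω * conj (divSum f g Y ω) ∂sumMeasure f g := by
  rw [integral_divSum hf hg hw, pairB]
  congr 1
  refine integral_congr_ae (Eventually.of_forall fun ω => ?_)
  simp only [divSum, map_div₀, Complex.conj_ofReal]
  push_cast
  ring

theorem pairR_eq (hf : IsSpectralDensity f) (hg : IsSpectralDensity g)
    (hw : ∀ᵐ ω, 0 < f ω + g ω) (Y : ℝ → ℂ) :
    pairR s N K a f g Y = 1 / (2 * Real.pi) *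
      ∫ ω, wiener s N K a f g ω * conj (divSum f g Y ω) ∂sumMeasure f g := by
  rw [integral_sumMeasure hf hg, pairR]
  congr 1
  refine integral_congr_ae (hw.mono fun ω hω => ?_)
  have h2 : ((f ω + g ω : ℝ) : ℂ) ≠ 0 := by exact_mod_cast hω.ne'
  simp only [divSum, wiener, map_div₀, Complex.conj_ofReal]
  field_simp

/-! ### The optimal estimate -/

theorem IsInvBR.memLp (ha : IntegrableOn a (weightSet s N K)) (hf : IsSpectralDensity f)
    (hg : IsSpectralDensity g) (hw : ∀ᵐ ω, 0 < f ω + g ω) {C : ℝ → ℂ}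
    (hC : IsInvBR s N K a f g C) :
    MemLp (charFormula s N K a f g C) 2 (sumMeasure f g) := by
  have : charFormula s N K a f g C = wiener s N K a f g - divSum f g C :=
    funext fun ω => charFormula_eq C ω
  rw [this]
  exact (memLp_wiener ha hf hg).sub (hC.1.memLp hf hg hw)

/-- The weak equation says that `A f / (f + g) - C / (f + g)` is orthogonal to every `Y / (f + g)`
of finite energy, that is, to the whole orthogonal complement of the observation space. -/
theorem IsInvBR.mem_obsSpace (ha : IntegrableOn a (weightSet s N K)) (hf : IsSpectralDensity f)
    (hg : IsSpectralDensity g) (hw : ∀ᵐ ω, 0 < f ω + g ω) {C : ℝ → ℂ}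
    (hC : IsInvBR s N K a f g C) : charFormula s N K a f g C ∈ obsSpace s N K f g := by
  refine (mem_obsSpace_iff hf hg).2 ⟨hC.memLp ha hf hg hw, fun Z hZ h0 => ?_⟩
  set Y : ℝ → ℂ := fun ω => ((f ω + g ω : ℝ) : ℂ) * Z ω with hYdef
  have hY := isSymbolOn_mul hf hg hw hZ h0
  have h1 := hC.2 Y hY
  rw [pairB_eq hf hg hw, pairR_eq hf hg hw] at h1
  have h2 := mul_left_cancel₀ (by simp [Real.pi_ne_zero]) h1
  have hd : divSum f g Y =ᵐ[sumMeasure f g] Z :=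
    sumMeasure_absolutelyContinuous.ae_le (hw.mono fun ω hω => by
      have h2 : ((f ω + g ω : ℝ) : ℂ) ≠ 0 := by exact_mod_cast hω.ne'
      simp only [divSum, hYdef]
      field_simp)
  have h3 : ∫ ω, charFormula s N K a f g C ω * conj (Z ω) ∂sumMeasure f g =
      ∫ ω, (wiener s N K a f g ω * conj (divSum f g Y ω) -
        divSum f g C ω * conj (divSum f g Y ω)) ∂sumMeasure f g := by
    refine integral_congr_ae (hd.mono fun ω hω => ?_)
    simp only [hω, charFormula_eq, sub_mul]
  rw [h3, integral_sub (integrable_mul_conj (memLp_wiener ha hf hg) (hY.memLp hf hg hw))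
    (integrable_mul_conj (hC.1.memLp hf hg hw) (hY.memLp hf hg hw)), h2, sub_self]

/-- `B⁻¹ R a` exists for every pair with `f + g > 0` almost everywhere. -/
theorem exists_isInvBR (ha : IntegrableOn a (weightSet s N K)) (hf : IsSpectralDensity f)
    (hg : IsSpectralDensity g) (hw : ∀ᵐ ω, 0 < f ω + g ω) : ∃ C, IsInvBR s N K a f g C := by
  obtain ⟨h, hh, h0⟩ := exists_projection_obsSpace (s := s) (N := N) (K := K) hf hg
    (memLp_wiener ha hf hg)
  have hFh : MemLp (fun ω => wiener s N K a f g ω - h ω) 2 (sumMeasure f g) :=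
    (memLp_wiener ha hf hg).sub hh.1
  -- The residual of the projection of `A f / (f + g)` onto the observation space, carried back to
  -- functions of finite energy.
  set C : ℝ → ℂ := fun ω => ((f ω + g ω : ℝ) : ℂ) * (wiener s N K a f g ω - h ω) with hCdef
  have hCs : IsSymbolOn s N K f g C := isSymbolOn_mul hf hg hw hFh h0
  have hd : divSum f g C =ᵐ[sumMeasure f g] fun ω => wiener s N K a f g ω - h ω :=
    sumMeasure_absolutelyContinuous.ae_le (hw.mono fun ω hω => by
      have h2 : ((f ω + g ω : ℝ) : ℂ) ≠ 0 := by exact_mod_cast hω.ne'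
      simp only [divSum, hCdef]
      field_simp)
  refine ⟨C, hCs, fun Y hY => ?_⟩
  rw [pairB_eq hf hg hw, pairR_eq hf hg hw]
  congr 1
  have h1 := ((mem_obsSpace_iff hf hg).1 hh).2 _ (hY.memLp hf hg hw) (hY.orthogonal hf hg hw)
  have h2 : ∫ ω, divSum f g C ω * conj (divSum f g Y ω) ∂sumMeasure f g =
      ∫ ω, (wiener s N K a f g ω * conj (divSum f g Y ω) -
        h ω * conj (divSum f g Y ω)) ∂sumMeasure f g := by
    refine integral_congr_ae (hd.mono fun ω hω => ?_)
    simp only [hω, sub_mul]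
  rw [h2, integral_sub (integrable_mul_conj (memLp_wiener ha hf hg) (hY.memLp hf hg hw))
    (integrable_mul_conj hh.1 (hY.memLp hf hg hw)), h1, sub_zero]

/-! ### Decomposition of the mean-square error -/

/-- The constant factor `1 / 2π` in `[0, ∞]`. -/
noncomputable def invTwoPi : ℝ≥0∞ := ENNReal.ofReal (1 / (2 * Real.pi))

theorem invTwoPi_ne_zero : invTwoPi ≠ 0 := by
  simp only [invTwoPi, ne_eq, ENNReal.ofReal_eq_zero, not_le]
  positivity

theorem invTwoPi_ne_top : invTwoPi ≠ ∞ := ENNReal.ofReal_ne_top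

theorem mse_eq_lintegral {A h : ℝ → ℂ} (hA : AEStronglyMeasurable A) (hh : AEStronglyMeasurable h)
    (hf : IsSpectralDensity f) :
    mse A h f g = invTwoPi * ∫⁻ ω,
      (‖A ω - h ω‖ₑ ^ 2 * ENNReal.ofReal (f ω) + ‖h ω‖ₑ ^ 2 * ENNReal.ofReal (g ω)) := by
  have hm : AEMeasurable fun ω => ‖A ω - h ω‖ₑ ^ 2 * ENNReal.ofReal (f ω) :=
    ((hA.sub hh).enorm.pow_const 2).mul hf.2.1.aemeasurable.ennreal_ofReal
  rw [lintegral_add_left' hm, mul_add]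
  rfl

/-- Decomposition of the error into the error from complete observations and the distance to the
corresponding characteristic. -/
theorem mse_eq_add (ha : IntegrableOn a (weightSet s N K)) (hf : IsSpectralDensity f)
    (hg : IsSpectralDensity g) (hw : ∀ᵐ ω, 0 < f ω + g ω) {h : ℝ → ℂ}
    (hh : AEStronglyMeasurable h) :
    mse (weightSymbol s N K a) h f g =
      invTwoPi * (∫⁻ ω, ‖weightSymbol s N K a ω‖ₑ ^ 2 *
          ENNReal.ofReal (f ω * g ω / (f ω + g ω))) +
        invTwoPi * ∫⁻ ω, ‖wiener s N K a f g ω - h ω‖ₑ ^ 2 ∂sumMeasure f g := by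
  have hA := (continuous_weightSymbol ha).aestronglyMeasurable (μ := volume)
  rw [mse_eq_lintegral hA hh hf, lintegral_sumMeasure hf hg, ← mul_add, ← lintegral_add_left']
  · congr 1
    refine lintegral_congr_ae ?_
    filter_upwards [hf.1, hg.1, hw] with ω h1 h2 h3
    have e : ∀ z : ℂ, ‖z‖ₑ ^ 2 = ENNReal.ofReal (‖z‖ ^ 2) := fun z => by
      rw [ENNReal.ofReal_pow (norm_nonneg _), ofReal_norm]
    simp only [e]
    rw [← ENNReal.ofReal_mul (by positivity), ← ENNReal.ofReal_mul (by positivity),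
      ← ENNReal.ofReal_mul (by positivity), ← ENNReal.ofReal_mul h3.le,
      ← ENNReal.ofReal_add (by positivity) (by positivity),
      ← ENNReal.ofReal_add (by positivity) (by positivity)]
    congr 1
    -- Completing the square: `|A - h|² f + |h|² g = |A|² f g / (f + g) + (f + g) |A f / (f + g) -
    -- h|²`.
    rw [wiener]
    simp only [← Complex.normSq_eq_norm_sq, Complex.normSq_apply, Complex.sub_re, Complex.sub_im,
      Complex.re_mul_ofReal, Complex.im_mul_ofReal]
    field_simp
    ring
  · exact (hA.enorm.pow_const 2).mul
      (((hf.2.1.mul hg.2.1).aemeasurable.div (aemeasurable_sum hf hg)).ennreal_ofReal)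

/-- Pythagoras' theorem for the error of an arbitrary estimate. -/
theorem IsInvBR.mse_eq (ha : IntegrableOn a (weightSet s N K)) (hf : IsSpectralDensity f)
    (hg : IsSpectralDensity g) (hw : ∀ᵐ ω, 0 < f ω + g ω) {C : ℝ → ℂ}
    (hC : IsInvBR s N K a f g C) {h : ℝ → ℂ} (hh : h ∈ obsSpace s N K f g) :
    mse (weightSymbol s N K a) h f g =
      mse (weightSymbol s N K a) (charFormula s N K a f g C) f g +
        invTwoPi * ∫⁻ ω, ‖charFormula s N K a f g C ω - h ω‖ₑ ^ 2 ∂sumMeasure f g := by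
  have hac := absolutelyContinuous_sumMeasure hf hg hw
  have hC2 := hC.memLp ha hf hg hw
  have hCd := hC.1.memLp hf hg hw
  have hsub : MemLp (fun ω => charFormula s N K a f g C ω - h ω) 2 (sumMeasure f g) :=
    hC2.sub hh.1
  rw [mse_eq_add ha hf hg hw (hh.1.1.mono_ac hac), mse_eq_add ha hf hg hw (hC2.1.mono_ac hac),
    add_assoc, ← mul_add invTwoPi (∫⁻ ω, ‖wiener s N K a f g ω - _‖ₑ ^ 2 ∂sumMeasure f g)]
  congr 2
  -- Both characteristics lie in the observation space, while `C / (f + g)` is orthogonal to it.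
  have horth : ∫ ω, (charFormula s N K a f g C ω - h ω) * conj (divSum f g C ω)
      ∂sumMeasure f g = 0 := by
    have h1 := ((mem_obsSpace_iff hf hg).1 hh).2 _ hCd (hC.1.orthogonal hf hg hw)
    have h2 := ((mem_obsSpace_iff hf hg).1 (hC.mem_obsSpace ha hf hg hw)).2 _ hCd
      (hC.1.orthogonal hf hg hw)
    simp only [sub_mul]
    rw [integral_sub (integrable_mul_conj hC2 hCd) (integrable_mul_conj hh.1 hCd), h1, h2, sub_zero]
  have hp := lintegral_enorm_add_sq_of_orthogonal hsub hCd horth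
  have e1 : ∀ ω, wiener s N K a f g ω - h ω =
      charFormula s N K a f g C ω - h ω + divSum f g C ω := fun ω => by
    rw [charFormula_eq]; ring
  have e2 : ∀ ω, wiener s N K a f g ω - charFormula s N K a f g C ω = divSum f g C ω := fun ω => by
    rw [charFormula_eq]; ring
  simp only [e1, e2]
  rw [hp, add_comm]

theorem IsInvBR.isOptimal (ha : IntegrableOn a (weightSet s N K)) (hf : IsSpectralDensity f)
    (hg : IsSpectralDensity g) (hw : ∀ᵐ ω, 0 < f ω + g ω) {C : ℝ → ℂ}
    (hC : IsInvBR s N K a f g C) : IsOptimal s N K a f g (charFormula s N K a f g C) := by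
  refine ⟨hC.mem_obsSpace ha hf hg hw, fun h hh => ?_⟩
  rw [hC.mse_eq ha hf hg hw hh]
  exact le_self_add

/-! ### The value of the extremal problem -/

/-- Fubini's theorem, the exponential having modulus one. The phase `φ` covers the two signs of `t`
needed for `Q`. -/
theorem integral_mul_integral_expi_swap {ν : Measure ℝ} [SFinite ν] {b κ : ℝ → ℂ}
    (hb : Integrable b ν) (hκ : Integrable κ) {φ : ℝ → ℝ} (hφ : Continuous φ) :
    ∫ t, b t * (∫ ω, κ ω * expi (φ t) ω) ∂ν = ∫ ω, κ ω * ∫ t, b t * expi (φ t) ω ∂ν := by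
  have hi : Integrable (fun p : ℝ × ℝ => b p.1 * κ p.2 * expi (φ p.1) p.2) (ν.prod volume) := by
    refine (hb.mul_prod hκ).mono ((hb.mul_prod hκ).1.mul (Continuous.aestronglyMeasurable ?_)) ?_
    · unfold expi; fun_prop
    · exact Eventually.of_forall fun p => by simp [norm_expi]
  have := integral_integral_swap (f := fun t ω => b t * κ ω * expi (φ t) ω) hi
  simp only [← integral_const_mul]
  refine Eq.trans ?_ (this.trans ?_)
  · simp only [mul_assoc]
  · congr 1; ext ω; congr 1; ext t; ring

theorem integrable_mul_div_add (hf : IsSpectralDensity f) (hg : IsSpectralDensity g) :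
    Integrable fun ω => f ω * g ω / (f ω + g ω) := by
  refine hf.2.mono' ((hf.2.1.mul hg.2.1).aemeasurable.div
    (aemeasurable_sum hf hg)).aestronglyMeasurable ?_
  filter_upwards [hf.1, hg.1] with ω h1 h2
  rw [Real.norm_of_nonneg (by positivity), mul_div_assoc]
  exact mul_le_of_le_one_right h1 (div_le_one_of_le₀ (by linarith) (by linarith))

/-- The kernel of `Q` depends on `t - u` only, so the Fourier transform diagonalizes its quadratic
form: two applications of Fubini produce `A` and its conjugate. This is the error from complete
observations in `mse_eq_add`. -/
theorem integral_opQ (hN : ∀ l, 0 ≤ N l) (hK : ∀ l, 0 ≤ K l) (ha : IntegrableOn a (weightSet s N K))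
    (hf : IsSpectralDensity f) (hg : IsSpectralDensity g) :
    ∫ t in timeSet s N K, opQ s N K f g (extWeight s N K a) t * conj (extWeight s N K a t) =
      ((1 / (2 * Real.pi) *
        ∫ ω, ‖weightSymbol s N K a ω‖ ^ 2 * (f ω * g ω / (f ω + g ω)) : ℝ) : ℂ) := by
  set κ : ℝ → ℂ := fun ω => ((f ω * g ω / (f ω + g ω) : ℝ) : ℂ) with hκdef
  have hκ : Integrable κ := (integrable_mul_div_add hf hg).ofReal
  have hb := integrableOn_extWeight (s := s) (N := N) (K := K) ha
  have hA := continuous_weightSymbol ha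
  have hexp : ∀ t : ℝ, Integrable fun ω => κ ω * expi t ω := fun t =>
    hκ.mono (hκ.1.mul (continuous_expi t).aestronglyMeasurable)
      (Eventually.of_forall fun ω => by simp [norm_expi])
  have h1 : ∀ t, opQ s N K f g (extWeight s N K a) t =
      1 / (2 * Real.pi) * ∫ ω, κ ω * weightSymbol s N K a ω * expi t ω := by
    intro t
    have hk : ∀ u, kernelQ f g t u =
        1 / (2 * Real.pi) * ∫ ω, κ ω * expi t ω * expi (-u) ω := by
      intro u
      rw [kernelQ]
      congr 2
      ext ω
      rw [sub_eq_add_neg, expi_add]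
      ring
    have := integral_mul_integral_expi_swap hb (hexp t) continuous_neg
    simp only [integral_extWeight_mul_expi hN hK] at this
    rw [opQ]
    simp only [hk, mul_left_comm _ (1 / (2 * (Real.pi : ℂ)))]
    rw [integral_const_mul, this]
    congr 2
    ext ω
    ring
  have hκA : Integrable fun ω => κ ω * weightSymbol s N K a ω :=
    hκ.mul_bdd hA.aestronglyMeasurable (Eventually.of_forall fun ω => norm_weightSymbol_le ω)
  have hbc : IntegrableOn (fun t => conj (extWeight s N K a t)) (timeSet s N K) := by
    refine Integrable.mono hb (Complex.continuous_conj.comp_aestronglyMeasurable hb.1) ?_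
    exact Eventually.of_forall fun t => by simp
  have h2 := integral_mul_integral_expi_swap hbc hκA continuous_id
  have h3 : ∀ ω, ∫ t in timeSet s N K, conj (extWeight s N K a t) * expi (id t) ω =
      conj (weightSymbol s N K a ω) := by
    intro ω
    rw [← integral_extWeight_mul_expi hN hK, ← integral_conj]
    simp only [map_mul, conj_expi, neg_neg, id]
  simp only [h3] at h2
  simp only [h1, mul_assoc (1 / (2 * (Real.pi : ℂ)))]
  rw [integral_const_mul]
  simp only [mul_comm _ (conj (extWeight s N K a _))]
  simp only [id] at h2
  rw [h2, Complex.ofReal_mul, ← integral_complex_ofReal]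
  push_cast
  congr 2
  ext ω
  rw [hκdef, mul_assoc, Complex.mul_conj, Complex.normSq_eq_norm_sq]
  push_cast
  ring

/-- The mean-square error of the optimal estimate is `⟨R a, B⁻¹ R a⟩ + ⟨Q a, a⟩`. -/
theorem IsInvBR.mse_charFormula (hN : ∀ l, 0 ≤ N l) (hK : ∀ l, 0 ≤ K l)
    (ha : IntegrableOn a (weightSet s N K)) (hf : IsSpectralDensity f)
    (hg : IsSpectralDensity g) (hw : ∀ᵐ ω, 0 < f ω + g ω) {C : ℝ → ℂ}
    (hC : IsInvBR s N K a f g C) :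
    mse (weightSymbol s N K a) (charFormula s N K a f g C) f g =
      ENNReal.ofReal (extremValue s N K a f g C) := by
  have hCd := hC.1.memLp hf hg hw
  have hB : (pairR s N K a f g C).re =
      1 / (2 * Real.pi) * ∫ ω, ‖divSum f g C ω‖ ^ 2 ∂sumMeasure f g := by
    -- Testing the weak equation with `y = c` gives `⟨R a, c⟩ = ⟨B c, c⟩`, the squared norm of `C /
    -- (f + g)` up to `1 / 2π`.
    rw [← hC.2 C hC.1, pairB_eq hf hg hw]
    have : ∫ ω, divSum f g C ω * conj (divSum f g C ω) ∂sumMeasure f g =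
        ((∫ ω, ‖divSum f g C ω‖ ^ 2 ∂sumMeasure f g : ℝ) : ℂ) := by
      rw [← integral_complex_ofReal]
      congr 1
      ext ω
      rw [Complex.mul_conj, Complex.normSq_eq_norm_sq]
    rw [this, ← Complex.ofReal_re (1 / (2 * Real.pi) * _)]
    push_cast
    rfl
  have e2 : ∀ ω, wiener s N K a f g ω - charFormula s N K a f g C ω = divSum f g C ω := fun ω => by
    rw [charFormula_eq]; ring
  have hA := continuous_weightSymbol ha
  have hκ := integrable_mul_div_add hf hg
  have hκ0 : ∀ᵐ ω, 0 ≤ ‖weightSymbol s N K a ω‖ ^ 2 * (f ω * g ω / (f ω + g ω)) := by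
    filter_upwards [hf.1, hg.1] with ω h1 h2
    positivity
  have hi : Integrable fun ω => ‖weightSymbol s N K a ω‖ ^ 2 * (f ω * g ω / (f ω + g ω)) := by
    refine hκ.bdd_mul (c := (∫ t in weightSet s N K, ‖a t‖) ^ 2)
      (hA.norm.pow 2).aestronglyMeasurable (Eventually.of_forall fun ω => ?_)
    rw [norm_pow, norm_norm]
    exact pow_le_pow_left₀ (norm_nonneg _) (norm_weightSymbol_le ω) 2
  rw [mse_eq_add ha hf hg hw ((hC.memLp ha hf hg hw).1.mono_ac
    (absolutelyContinuous_sumMeasure hf hg hw)), extremValue, Complex.add_re, hB,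
    integral_opQ hN hK ha hf hg, Complex.ofReal_re]
  simp only [e2]
  rw [lintegral_enorm_sq_eq_ofReal hCd, invTwoPi, add_comm (1 / (2 * Real.pi) * _ : ℝ),
    ENNReal.ofReal_add (mul_nonneg (by positivity) (integral_nonneg_of_ae hκ0))
      (mul_nonneg (by positivity) (integral_nonneg fun _ => by positivity)),
    ENNReal.ofReal_mul (by positivity), ENNReal.ofReal_mul (by positivity),
    ofReal_integral_eq_lintegral_ofReal hi hκ0]
  congr 2
  refine lintegral_congr fun ω => ?_
  rw [ENNReal.ofReal_mul (by positivity), ENNReal.ofReal_pow (norm_nonneg _), ofReal_norm]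

end Filtering

section Minimax

variable {s : ℕ} {N K : ℕ → ℝ} {a : ℝ → ℂ} {f g f₀ g₀ : ℝ → ℝ}

/-! ### Convex combinations of densities -/

/-- The convex combination `(1 - t) f₀ + t f`. -/
def mix (t : ℝ) (f₀ f : ℝ → ℝ) (ω : ℝ) : ℝ := (1 - t) * f₀ ω + t * f ω

theorem IsSpectralDensity.mix {t : ℝ} (ht : t ∈ Icc (0 : ℝ) 1) (hf₀ : IsSpectralDensity f₀)
    (hf : IsSpectralDensity f) : IsSpectralDensity (mix t f₀ f) := by
  refine ⟨?_, (hf₀.2.const_mul _).add (hf.2.const_mul _)⟩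
  filter_upwards [hf₀.1, hf.1] with ω h1 h2
  exact add_nonneg (mul_nonneg (by linarith [ht.2]) h1) (mul_nonneg ht.1 h2)

theorem mix_mem_L2Ball {f₁ : ℝ → ℝ} (hf₁ : IsSpectralDensity f₁) {ε t : ℝ}
    (ht : t ∈ Icc (0 : ℝ) 1) (hf₀ : f₀ ∈ L2Ball f₁ ε) (hf : f ∈ L2Ball f₁ ε) :
    mix t f₀ f ∈ L2Ball f₁ ε := by
  have hd := hf₀.1.mix ht hf.1
  have hi := (hf₀.2.1.const_mul (1 - t)).add (hf.2.1.const_mul t)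
  have hle : ∀ ω, |mix t f₀ f ω - f₁ ω| ^ 2 ≤
      (1 - t) * |f₀ ω - f₁ ω| ^ 2 + t * |f ω - f₁ ω| ^ 2 := by
    intro ω
    simp only [sq_abs, mix]
    -- The defect in the convexity of the square is exactly `t (1 - t) (f₀ - f)²`.
    nlinarith [mul_nonneg (mul_nonneg ht.1 (sub_nonneg.2 ht.2)) (sq_nonneg (f₀ ω - f ω))]
  have hi' : Integrable fun ω => |mix t f₀ f ω - f₁ ω| ^ 2 := by
    refine hi.mono' ((hd.2.sub hf₁.2).1.norm.pow 2) (Eventually.of_forall fun ω => ?_)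
    rw [Real.norm_of_nonneg (by positivity)]
    exact hle ω
  refine ⟨hd, hi', ?_⟩
  have h1 : ∫ ω, |mix t f₀ f ω - f₁ ω| ^ 2 ≤
      (1 - t) * (∫ ω, |f₀ ω - f₁ ω| ^ 2) + t * ∫ ω, |f ω - f₁ ω| ^ 2 := by
    rw [← integral_const_mul, ← integral_const_mul,
      ← integral_add (hf₀.2.1.const_mul _) (hf.2.1.const_mul _)]
    exact integral_mono hi' hi hle
  calc 1 / (2 * Real.pi) * ∫ ω, |mix t f₀ f ω - f₁ ω| ^ 2
      ≤ 1 / (2 * Real.pi) *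
          ((1 - t) * (∫ ω, |f₀ ω - f₁ ω| ^ 2) + t * ∫ ω, |f ω - f₁ ω| ^ 2) := by gcongr
    _ = (1 - t) * (1 / (2 * Real.pi) * ∫ ω, |f₀ ω - f₁ ω| ^ 2) +
          t * (1 / (2 * Real.pi) * ∫ ω, |f ω - f₁ ω| ^ 2) := by ring
    _ ≤ (1 - t) * ε + t * ε := by
        gcongr
        · linarith [ht.2]
        · exact hf₀.2.2
        · exact ht.1
        · exact hf.2.2
    _ = ε := by ring

theorem ofReal_mix {t : ℝ} (ht : t ∈ Icc (0 : ℝ) 1) {ω : ℝ} (h₀ : 0 ≤ f₀ ω) (h : 0 ≤ f ω) :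
    ENNReal.ofReal (mix t f₀ f ω) =
      ENNReal.ofReal (1 - t) * ENNReal.ofReal (f₀ ω) + ENNReal.ofReal t * ENNReal.ofReal (f ω) := by
  have ht' : 0 ≤ 1 - t := sub_nonneg.2 ht.2
  rw [mix, ENNReal.ofReal_add (mul_nonneg ht' h₀) (mul_nonneg ht.1 h), ENNReal.ofReal_mul ht',
    ENNReal.ofReal_mul ht.1]

theorem mse_mix {A h : ℝ → ℂ} (hA : AEStronglyMeasurable A) (hh : AEStronglyMeasurable h)
    {t : ℝ} (ht : t ∈ Icc (0 : ℝ) 1) (hf₀ : IsSpectralDensity f₀) (hg₀ : IsSpectralDensity g₀)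
    (hf : IsSpectralDensity f) (hg : IsSpectralDensity g) :
    mse A h (mix t f₀ f) (mix t g₀ g) =
      ENNReal.ofReal (1 - t) * mse A h f₀ g₀ + ENNReal.ofReal t * mse A h f g := by
  have hm : AEMeasurable fun ω => ENNReal.ofReal (1 - t) *
      (‖A ω - h ω‖ₑ ^ 2 * ENNReal.ofReal (f₀ ω) + ‖h ω‖ₑ ^ 2 * ENNReal.ofReal (g₀ ω)) :=
    ((((hA.sub hh).enorm.pow_const 2).mul hf₀.2.1.aemeasurable.ennreal_ofReal).add
      ((hh.enorm.pow_const 2).mul hg₀.2.1.aemeasurable.ennreal_ofReal)).const_mul _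
  rw [mse_eq_lintegral hA hh (hf₀.mix ht hf), mse_eq_lintegral hA hh hf₀,
    mse_eq_lintegral hA hh hf, mul_left_comm, mul_left_comm (ENNReal.ofReal t), ← mul_add,
    ← lintegral_const_mul' _ _ ENNReal.ofReal_ne_top,
    ← lintegral_const_mul' _ _ ENNReal.ofReal_ne_top, ← lintegral_add_left' hm]
  congr 1
  refine lintegral_congr_ae ?_
  filter_upwards [hf₀.1, hf.1, hg₀.1, hg.1] with ω h1 h2 h3 h4
  rw [ofReal_mix ht h1 h2, ofReal_mix ht h3 h4]
  ring

/-! ### Bounds by the mean-square error -/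

theorem enorm_sub_sq_le (x y : ℂ) : ‖x - y‖ₑ ^ 2 ≤ 2 * ‖x‖ₑ ^ 2 + 2 * ‖y‖ₑ ^ 2 := by
  have e : ∀ z : ℂ, ‖z‖ₑ ^ 2 = ENNReal.ofReal (‖z‖ ^ 2) := fun z => by
    rw [ENNReal.ofReal_pow (norm_nonneg _), ofReal_norm]
  have e2 : (2 : ℝ≥0∞) = ENNReal.ofReal 2 := by simp
  rw [e, e, e, e2, ← ENNReal.ofReal_mul zero_le_two, ← ENNReal.ofReal_mul zero_le_two,
    ← ENNReal.ofReal_add (by positivity) (by positivity)]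
  refine ENNReal.ofReal_le_ofReal ?_
  have := norm_sub_le x y
  nlinarith [norm_nonneg (x - y), sq_nonneg (‖x‖ - ‖y‖)]

/-- From `|h|² ≤ 2 |A|² + 2 |A - h|²` on the `f` part. Thus estimates with bounded error are bounded
in `L²(f + g)`, which the weak limit needs. -/
theorem lintegral_sumMeasure_le_mse {A h : ℝ → ℂ} (hA : AEStronglyMeasurable A)
    (hh : AEStronglyMeasurable h) (hf : IsSpectralDensity f) (hg : IsSpectralDensity g) :
    ∫⁻ ω, ‖h ω‖ₑ ^ 2 ∂sumMeasure f g ≤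
      2 * (invTwoPi⁻¹ * mse A h f g) + 2 * ∫⁻ ω, ‖A ω‖ₑ ^ 2 * ENNReal.ofReal (f ω) := by
  have hm : AEMeasurable fun ω => ‖A ω‖ₑ ^ 2 * ENNReal.ofReal (f ω) :=
    (hA.enorm.pow_const 2).mul hf.2.1.aemeasurable.ennreal_ofReal
  rw [mse_eq_lintegral hA hh hf, ← mul_assoc invTwoPi⁻¹,
    ENNReal.inv_mul_cancel invTwoPi_ne_zero invTwoPi_ne_top, one_mul, lintegral_sumMeasure hf hg,
    ← mul_add, ← lintegral_add_right' _ hm, ← lintegral_const_mul' _ _ (by norm_num)]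
  refine lintegral_mono_ae ?_
  filter_upwards [hf.1, hg.1] with ω h1 h2
  have h3 := enorm_sub_sq_le (A ω) (A ω - h ω)
  rw [sub_sub_cancel] at h3
  rw [ENNReal.ofReal_add h1 h2, add_mul]
  calc ENNReal.ofReal (f ω) * ‖h ω‖ₑ ^ 2 + ENNReal.ofReal (g ω) * ‖h ω‖ₑ ^ 2
      ≤ ENNReal.ofReal (f ω) * (2 * ‖A ω‖ₑ ^ 2 + 2 * ‖A ω - h ω‖ₑ ^ 2) +
          2 * (ENNReal.ofReal (g ω) * ‖h ω‖ₑ ^ 2) := by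
        refine add_le_add (by gcongr) ?_
        rw [two_mul]
        exact le_self_add
    _ = _ := by ring

theorem lintegral_weightSymbol_lt_top (hf : IsSpectralDensity f) :
    ∫⁻ ω, ‖weightSymbol s N K a ω‖ₑ ^ 2 * ENNReal.ofReal (f ω) < ∞ := by
  set c : ℝ≥0∞ := ENNReal.ofReal (∫ t in weightSet s N K, ‖a t‖) ^ 2
  calc ∫⁻ ω, ‖weightSymbol s N K a ω‖ₑ ^ 2 * ENNReal.ofReal (f ω)
      ≤ ∫⁻ ω, c * ENNReal.ofReal (f ω) := by
        refine lintegral_mono fun ω => ?_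
        have h1 : ‖weightSymbol s N K a ω‖ₑ ≤ ENNReal.ofReal (∫ t in weightSet s N K, ‖a t‖) := by
          rw [← ofReal_norm]
          exact ENNReal.ofReal_le_ofReal (norm_weightSymbol_le ω)
        gcongr
        exact pow_le_pow_left' h1 2
    _ < ∞ := by
        rw [lintegral_const_mul' _ _ (by simp [c])]
        refine ENNReal.mul_lt_top (by simp [c, lt_top_iff_ne_top]) ?_
        rw [← ofReal_integral_eq_lintegral_ofReal hf.2 hf.1]
        exact ENNReal.ofReal_lt_top

/-- Lower semicontinuity of the error under almost everywhere convergence. -/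
theorem mse_le_of_tendsto_ae {A h : ℝ → ℂ} {k : ℕ → ℝ → ℂ} {m : ℝ≥0∞}
    (hA : AEStronglyMeasurable A) (hh : AEStronglyMeasurable h)
    (hk : ∀ n, AEStronglyMeasurable (k n)) (hf : IsSpectralDensity f) (hg : IsSpectralDensity g)
    (hlim : ∀ᵐ ω, Tendsto (fun n => k n ω) atTop (𝓝 (h ω)))
    (hm : ∀ n, mse A (k n) f g ≤ m) : mse A h f g ≤ m := by
  have hsq : ∀ {u : ℕ → ℂ} {z : ℂ} {b : ℝ}, Tendsto u atTop (𝓝 z) →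
      Tendsto (fun n => ‖u n‖ₑ ^ 2 * ENNReal.ofReal b) atTop (𝓝 (‖z‖ₑ ^ 2 * ENNReal.ofReal b)) := by
    intro u z b hu
    refine ENNReal.Tendsto.mul_const ?_ (Or.inr ENNReal.ofReal_ne_top)
    exact ((ENNReal.continuous_pow 2).tendsto _).comp ((continuous_enorm.tendsto z).comp hu)
  have hle : ∀ n, ∫⁻ ω, (‖A ω - k n ω‖ₑ ^ 2 * ENNReal.ofReal (f ω) +
      ‖k n ω‖ₑ ^ 2 * ENNReal.ofReal (g ω)) ≤ invTwoPi⁻¹ * m := by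
    intro n
    have := hm n
    rw [mse_eq_lintegral hA (hk n) hf] at this
    rwa [← ENNReal.div_eq_inv_mul, ENNReal.le_div_iff_mul_le (Or.inl invTwoPi_ne_zero)
      (Or.inl invTwoPi_ne_top), mul_comm]
  rw [mse_eq_lintegral hA hh hf]
  calc invTwoPi * ∫⁻ ω, (‖A ω - h ω‖ₑ ^ 2 * ENNReal.ofReal (f ω) +
        ‖h ω‖ₑ ^ 2 * ENNReal.ofReal (g ω))
      = invTwoPi * ∫⁻ ω, liminf (fun n => ‖A ω - k n ω‖ₑ ^ 2 * ENNReal.ofReal (f ω) +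
          ‖k n ω‖ₑ ^ 2 * ENNReal.ofReal (g ω)) atTop := by
        congr 1
        refine lintegral_congr_ae (hlim.mono fun ω hω => ?_)
        exact ((hsq (hω.const_sub (A ω))).add (hsq hω)).liminf_eq.symm
    _ ≤ invTwoPi * liminf (fun n => ∫⁻ ω, (‖A ω - k n ω‖ₑ ^ 2 * ENNReal.ofReal (f ω) +
          ‖k n ω‖ₑ ^ 2 * ENNReal.ofReal (g ω))) atTop := by
        gcongr
        exact lintegral_liminf_le' fun n =>
          (((hA.sub (hk n)).enorm.pow_const 2).mul hf.2.1.aemeasurable.ennreal_ofReal).add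
            (((hk n).enorm.pow_const 2).mul hg.2.1.aemeasurable.ennreal_ofReal)
    _ ≤ invTwoPi * (invTwoPi⁻¹ * m) := by
        gcongr
        exact liminf_le_of_le (by isBoundedDefault) fun b hb => by
          obtain ⟨n, hn⟩ := hb.exists
          exact hn.trans (hle n)
    _ = m := by
        rw [← mul_assoc, ENNReal.mul_inv_cancel invTwoPi_ne_zero invTwoPi_ne_top, one_mul]

/-! ### The saddle point -/

/-- Along the segment from a solution of the extremal problem to another pair of densities, the
optimal characteristics have error at most `m` at the endpoint and converge at the origin. -/
theorem exists_approx (hN : ∀ l, 0 ≤ N l) (hK : ∀ l, 0 ≤ K l)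
    (ha : IntegrableOn a (weightSet s N K)) (hf₀ : IsSpectralDensity f₀)
    (hg₀ : IsSpectralDensity g₀) (hmin : Minimality f₀ g₀) {C₀ : ℝ → ℂ}
    (hC₀ : IsInvBR s N K a f₀ g₀ C₀) (hf : IsSpectralDensity f) (hg : IsSpectralDensity g)
    {t : ℝ} (ht : 0 < t) (ht' : t ≤ 1 / 2)
    (hext : ∀ C, Minimality (mix t f₀ f) (mix t g₀ g) →
      IsInvBR s N K a (mix t f₀ f) (mix t g₀ g) C →
      extremValue s N K a (mix t f₀ f) (mix t g₀ g) C ≤ extremValue s N K a f₀ g₀ C₀) :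
    ∃ k, AEStronglyMeasurable k ∧ k ∈ obsSpace s N K f₀ g₀ ∧ k ∈ obsSpace s N K f g ∧
      mse (weightSymbol s N K a) k f g ≤ ENNReal.ofReal (extremValue s N K a f₀ g₀ C₀) ∧
      ∫⁻ ω, ‖charFormula s N K a f₀ g₀ C₀ ω - k ω‖ₑ ^ 2 ∂sumMeasure f₀ g₀ ≤
        (ENNReal.ofReal (1 / 2) * invTwoPi)⁻¹ *
          (ENNReal.ofReal t * ENNReal.ofReal (extremValue s N K a f₀ g₀ C₀)) := by
  have ht1 : t ∈ Icc (0 : ℝ) 1 := ⟨ht.le, by linarith⟩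
  have hw₀ := hmin.ae_pos hf₀ hg₀
  have hft := hf₀.mix ht1 hf
  have hgt := hg₀.mix ht1 hg
  -- The mixture dominates a positive multiple of each endpoint. So it inherits minimality from
  -- `(f₀, g₀)`, and its observation space is contained in both endpoint spaces.
  have hle₀ : ∀ᵐ ω, (1 - t) * (f₀ ω + g₀ ω) ≤ mix t f₀ f ω + mix t g₀ g ω := by
    filter_upwards [hf.1, hg.1] with ω h1 h2
    simp only [mix]
    nlinarith [mul_nonneg ht.le h1, mul_nonneg ht.le h2]
  have hle : ∀ᵐ ω, t * (f ω + g ω) ≤ mix t f₀ f ω + mix t g₀ g ω := by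
    filter_upwards [hf₀.1, hg₀.1] with ω h1 h2
    simp only [mix]
    nlinarith [mul_nonneg (sub_nonneg.2 ht1.2) h1, mul_nonneg (sub_nonneg.2 ht1.2) h2]
  have hmint : Minimality (mix t f₀ f) (mix t g₀ g) := hmin.mono (by linarith) hle₀
  have hwt := hmint.ae_pos hft hgt
  obtain ⟨C, hC⟩ := exists_isInvBR ha hft hgt hwt
  set k := charFormula s N K a (mix t f₀ f) (mix t g₀ g) C
  have hko := hC.mem_obsSpace ha hft hgt hwt
  have hkm : AEStronglyMeasurable k :=
    hko.1.1.mono_ac (absolutelyContinuous_sumMeasure hft hgt hwt)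
  have hk₀ : k ∈ obsSpace s N K f₀ g₀ := obsSpace_mono (by linarith) hle₀ hko
  have hA := (continuous_weightSymbol ha).aestronglyMeasurable (μ := volume)
  set m := ENNReal.ofReal (extremValue s N K a f₀ g₀ C₀) with hm
  have h1 : mse (weightSymbol s N K a) k (mix t f₀ f) (mix t g₀ g) ≤ m := by
    rw [hC.mse_charFormula hN hK ha hft hgt hwt]
    exact ENNReal.ofReal_le_ofReal (hext C hmint hC)
  -- Splitting `m` lets the finite term `(1 - t) m`, the error of the optimal characteristic at
  -- `(f₀, g₀)`, cancel; what remains is an inequality with right-hand side `t m`.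
  have hsum : m = ENNReal.ofReal (1 - t) * m + ENNReal.ofReal t * m := by
    rw [← add_mul, ← ENNReal.ofReal_add (by linarith) ht.le]
    simp
  have hfin : ENNReal.ofReal (1 - t) * m ≠ ∞ :=
    ENNReal.mul_ne_top ENNReal.ofReal_ne_top ENNReal.ofReal_ne_top
  rw [mse_mix hA hkm ht1 hf₀ hg₀ hf hg, hC₀.mse_eq ha hf₀ hg₀ hw₀ hk₀,
    hC₀.mse_charFormula hN hK ha hf₀ hg₀ hw₀, ← hm, mul_add, add_assoc] at h1
  nth_rewrite 2 [hsum] at h1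
  rw [ENNReal.add_le_add_iff_left hfin] at h1
  refine ⟨k, hkm, hk₀, obsSpace_mono ht hle hko, ?_, ?_⟩
  · have h2 := le_add_self.trans h1
    exact (ENNReal.mul_le_mul_iff_right (by simpa using ht) ENNReal.ofReal_ne_top).1 h2
  · have h2 := le_self_add.trans h1
    -- The constant `1 / 2` is a lower bound for `1 - t`, uniform in `t ≤ 1 / 2`.
    have h3 : ENNReal.ofReal (1 / 2) * invTwoPi ≠ 0 :=
      mul_ne_zero (by simp) invTwoPi_ne_zero
    rw [← ENNReal.div_eq_inv_mul, ENNReal.le_div_iff_mul_le (Or.inl h3)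
      (Or.inl (ENNReal.mul_ne_top ENNReal.ofReal_ne_top invTwoPi_ne_top)), mul_comm, mul_assoc]
    refine le_trans ?_ h2
    gcongr
    linarith

/-- A solution of the extremal problem is a saddle point: its characteristic is a linear estimate
for every pair on a segment ending there, with no larger error. -/
theorem saddle_point (hN : ∀ l, 0 ≤ N l) (hK : ∀ l, 0 ≤ K l)
    (ha : IntegrableOn a (weightSet s N K)) (hf₀ : IsSpectralDensity f₀)
    (hg₀ : IsSpectralDensity g₀) (hmin : Minimality f₀ g₀) {C₀ : ℝ → ℂ}
    (hC₀ : IsInvBR s N K a f₀ g₀ C₀) (hf : IsSpectralDensity f) (hg : IsSpectralDensity g)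
    (hext : ∀ t ∈ Icc (0 : ℝ) 1, ∀ C, Minimality (mix t f₀ f) (mix t g₀ g) →
      IsInvBR s N K a (mix t f₀ f) (mix t g₀ g) C →
      extremValue s N K a (mix t f₀ f) (mix t g₀ g) C ≤ extremValue s N K a f₀ g₀ C₀) :
    charFormula s N K a f₀ g₀ C₀ ∈ obsSpace s N K f g ∧
      mse (weightSymbol s N K a) (charFormula s N K a f₀ g₀ C₀) f g ≤
        mse (weightSymbol s N K a) (charFormula s N K a f₀ g₀ C₀) f₀ g₀ := by
  have hw₀ := hmin.ae_pos hf₀ hg₀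
  have hac₀ := absolutelyContinuous_sumMeasure hf₀ hg₀ hw₀
  have hA := (continuous_weightSymbol ha).aestronglyMeasurable (μ := volume)
  rw [hC₀.mse_charFormula hN hK ha hf₀ hg₀ hw₀]
  set h₀ := charFormula s N K a f₀ g₀ C₀
  set m := ENNReal.ofReal (extremValue s N K a f₀ g₀ C₀) with hm
  have hh₀ : MemLp h₀ 2 (sumMeasure f₀ g₀) := hC₀.memLp ha hf₀ hg₀ hw₀
  have hh₀m : AEStronglyMeasurable h₀ := hh₀.1.mono_ac hac₀
  have htn : ∀ n : ℕ, (0 : ℝ) < 1 / ((n : ℝ) + 2) ∧ 1 / ((n : ℝ) + 2) ≤ 1 / 2 := fun n =>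
    ⟨by positivity, one_div_le_one_div_of_le two_pos (by linarith [Nat.cast_nonneg (α := ℝ) n])⟩
  choose k hkm hk₀ hkf hmse hdist using fun n : ℕ =>
    exists_approx hN hK ha hf₀ hg₀ hmin hC₀ hf hg (htn n).1 (htn n).2
      (hext _ ⟨(htn n).1.le, by linarith [(htn n).2]⟩)
  have hlim0 : Tendsto (fun n : ℕ => (ENNReal.ofReal (1 / 2) * invTwoPi)⁻¹ *
      (ENNReal.ofReal (1 / ((n : ℝ) + 2)) * m)) atTop (𝓝 0) := by
    have h1 : Tendsto (fun n : ℕ => (1 : ℝ) / ((n : ℝ) + 2)) atTop (𝓝 0) := by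
      simp only [one_div]
      exact tendsto_inv_atTop_zero.comp
        (tendsto_atTop_add_const_right _ _ tendsto_natCast_atTop_atTop)
    have h2 := ENNReal.tendsto_ofReal h1
    rw [ENNReal.ofReal_zero] at h2
    have h3 := ENNReal.Tendsto.mul_const (b := m) h2 (Or.inr ENNReal.ofReal_ne_top)
    have h4 : (ENNReal.ofReal (1 / 2) * invTwoPi)⁻¹ ≠ ∞ := by
      rw [ne_eq, ENNReal.inv_eq_top]
      exact mul_ne_zero (by simp) invTwoPi_ne_zero
    have h5 := ENNReal.Tendsto.const_mul h3 (Or.inr h4)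
    simpa using h5
  have hL2 : Tendsto (fun n => eLpNorm (k n - h₀) 2 (sumMeasure f₀ g₀)) atTop (𝓝 0) := by
    have h1 : Tendsto (fun n => eLpNorm (k n - h₀) 2 (sumMeasure f₀ g₀) ^ 2) atTop (𝓝 0) := by
      refine tendsto_of_tendsto_of_tendsto_of_le_of_le tendsto_const_nhds hlim0
        (fun n => zero_le) fun n => ?_
      rw [eLpNorm_sub_comm, eLpNorm_two_sq]
      exact hdist n
    have h2 := h1.ennrpow_const (1 / 2)
    rw [ENNReal.zero_rpow_of_pos (by norm_num)] at h2
    refine h2.congr fun n => ?_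
    rw [← ENNReal.rpow_natCast, ← ENNReal.rpow_mul]
    norm_num
  obtain ⟨φ, -, hφ⟩ := (tendstoInMeasure_of_tendsto_eLpNorm (by norm_num)
    (fun n => (hk₀ n).1.1) hh₀.1 hL2).exists_seq_tendsto_ae
  -- Positivity of `f₀ + g₀` turns convergence almost everywhere for `(f₀ + g₀) dω` into Lebesgue
  -- almost everywhere, hence also for `(f + g) dω`, whatever `f + g` is.
  have hlim : ∀ᵐ ω, Tendsto (fun n => k (φ n) ω) atTop (𝓝 (h₀ ω)) := hac₀.ae_le hφ
  have hfatou : mse (weightSymbol s N K a) h₀ f g ≤ m :=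
    mse_le_of_tendsto_ae hA hh₀m (fun n => hkm (φ n)) hf hg hlim fun n => hmse (φ n)
  refine ⟨?_, hfatou⟩
  set M : ℝ≥0∞ := 2 * (invTwoPi⁻¹ * m) +
    2 * ∫⁻ ω, ‖weightSymbol s N K a ω‖ₑ ^ 2 * ENNReal.ofReal (f ω) with hMdef
  have hM : M ≠ ∞ := by
    refine ENNReal.add_ne_top.2 ⟨ENNReal.mul_ne_top (by norm_num) (ENNReal.mul_ne_top ?_
      ENNReal.ofReal_ne_top), ENNReal.mul_ne_top (by norm_num) (lintegral_weightSymbol_lt_top hf).ne⟩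
    simpa using invTwoPi_ne_zero
  have hbd : ∀ h, AEStronglyMeasurable h → mse (weightSymbol s N K a) h f g ≤ m →
      ∫⁻ ω, ‖h ω‖ₑ ^ 2 ∂sumMeasure f g ≤ M := fun h hh hle =>
    (lintegral_sumMeasure_le_mse hA hh hf hg).trans (by rw [hMdef]; gcongr)
  have hac : sumMeasure f g ≪ volume := sumMeasure_absolutelyContinuous
  have hh₀f : MemLp h₀ 2 (sumMeasure f g) :=
    memLp_two_of_lintegral_lt_top (hh₀m.mono_ac hac) ((hbd h₀ hh₀m hfatou).trans_lt hM.lt_top)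
  refine (mem_obsSpace_iff hf hg).2 ⟨hh₀f, fun Y hY hY0 => ?_⟩
  refine integral_mul_conj_eq_zero_of_tendsto_ae (k := fun n => k (φ n)) (M := 2 * M + 2 * M) ?_
    (fun n => (hkf (φ n)).1) hh₀f hY (fun n => ?_) (hac.ae_le hlim)
    (fun n => ((mem_obsSpace_iff hf hg).1 (hkf (φ n))).2 Y hY hY0)
  · finiteness
  · calc ∫⁻ ω, ‖k (φ n) ω - h₀ ω‖ₑ ^ 2 ∂sumMeasure f g
        ≤ ∫⁻ ω, (2 * ‖k (φ n) ω‖ₑ ^ 2 + 2 * ‖h₀ ω‖ₑ ^ 2) ∂sumMeasure f g :=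
          lintegral_mono fun ω => enorm_sub_sq_le _ _
      _ = 2 * (∫⁻ ω, ‖k (φ n) ω‖ₑ ^ 2 ∂sumMeasure f g) +
            2 * ∫⁻ ω, ‖h₀ ω‖ₑ ^ 2 ∂sumMeasure f g := by
          rw [lintegral_add_left' ((((hkm (φ n)).mono_ac hac).enorm.pow_const 2).const_mul 2),
            lintegral_const_mul' _ _ (by norm_num), lintegral_const_mul' _ _ (by norm_num)]
      _ ≤ 2 * M + 2 * M := by
          gcongr
          · exact hbd _ (hkm (φ n)) (hmse (φ n))
          · exact hbd _ hh₀m hfatou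

/-- For any pair of `D` the smallest error is at most that of `h₀`, hence at most its error at `(f₀,
g₀)`. Any competitor in the common space has worst error at least its error at `(f₀, g₀)`, where
`h₀` is optimal. -/
theorem IsOptimal.isLeastFavorable_and_isMinimaxRobust {D : Set ((ℝ → ℝ) × (ℝ → ℝ))}
    (hD : (f₀, g₀) ∈ D) {h₀ : ℝ → ℂ} (hopt : IsOptimal s N K a f₀ g₀ h₀)
    (hsaddle : ∀ q ∈ D, h₀ ∈ obsSpace s N K q.1 q.2 ∧
      mse (weightSymbol s N K a) h₀ q.1 q.2 ≤ mse (weightSymbol s N K a) h₀ f₀ g₀) :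
    IsLeastFavorable s N K a D f₀ g₀ ∧ IsMinimaxRobust s N K a D h₀ := by
  have hcommon : h₀ ∈ commonSpace s N K D := mem_iInter₂.2 fun q hq => (hsaddle q hq).1
  refine ⟨⟨hD, h₀, hopt, ⟨f₀, g₀, h₀, hD, hopt, rfl⟩, ?_⟩, hcommon,
    mse (weightSymbol s N K a) h₀ f₀ g₀, ⟨⟨_, hD, rfl⟩, ?_⟩, ⟨h₀, hcommon, ?_⟩, ?_⟩
  · rintro _ ⟨f, g, h, hq, hh, rfl⟩
    exact (hh.2 h₀ (hsaddle _ hq).1).trans (hsaddle _ hq).2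
  · rintro _ ⟨q, hq, rfl⟩
    exact (hsaddle q hq).2
  · refine le_antisymm (iSup₂_le fun q hq => (hsaddle q hq).2) ?_
    exact le_iSup₂ (f := fun (q : (ℝ → ℝ) × (ℝ → ℝ)) (_ : q ∈ D) =>
      mse (weightSymbol s N K a) h₀ q.1 q.2) (f₀, g₀) hD
  · rintro _ ⟨h, hh, rfl⟩
    have hh' : h ∈ obsSpace s N K f₀ g₀ := mem_iInter₂.1 hh (f₀, g₀) hD
    refine (hopt.2 h hh').trans ?_
    exact le_iSup₂ (f := fun (q : (ℝ → ℝ) × (ℝ → ℝ)) (_ : q ∈ D) =>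
      mse (weightSymbol s N K a) h q.1 q.2) (f₀, g₀) hD

end Minimax

end MissingFilter

/-! ### The theorem for the product of two `L²` balls -/

theorem mainTheorem4
    (s : ℕ) (N K : ℕ → ℝ) (hN0 : N 0 = 0) (hK0 : K 0 = 0)
    (hN : ∀ l, 0 ≤ N l) (hK : ∀ l, 0 ≤ K l)
    (a : ℝ → ℂ)
    (ha : MeasureTheory.IntegrableOn a (MissingFilter.weightSet s N K))
    (ha2 : MeasureTheory.IntegrableOn (fun t => t * ‖a t‖ ^ 2) (MissingFilter.weightSet s N K))
    (f₁ g₁ : ℝ → ℝ) (hf₁ : MissingFilter.IsSpectralDensity f₁)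
    (hg₁ : MissingFilter.IsSpectralDensity g₁) (ε₁ ε₂ : ℝ)
    (f₀ g₀ : ℝ → ℝ) (hf₀ : f₀ ∈ MissingFilter.L2Ball f₁ ε₁) (hg₀ : g₀ ∈ MissingFilter.L2Ball g₁ ε₂)
    (hmin : MissingFilter.Minimality f₀ g₀)
    (C₀ : ℝ → ℂ) (hC₀ : MissingFilter.IsInvBR s N K a f₀ g₀ C₀)
    (hbf : ∃ M : ℝ, ∀ᵐ ω, ‖MissingFilter.weightSymbol s N K a ω * (g₀ ω : ℂ) + C₀ ω‖ ^ 2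
      / (f₀ ω + g₀ ω) ^ 2 ≤ M)
    (hbg : ∃ M : ℝ, ∀ᵐ ω, ‖MissingFilter.weightSymbol s N K a ω * (f₀ ω : ℂ) - C₀ ω‖ ^ 2
      / (f₀ ω + g₀ ω) ^ 2 ≤ M)
    (α₁ α₂ : ℝ) (hα₁ : 0 ≤ α₁) (hα₂ : 0 ≤ α₂)
    (p : ℕ) (hp : p = 1 ∨ p = 2)
    (hef : ∀ᵐ ω, ‖MissingFilter.weightSymbol s N K a ω * (g₀ ω : ℂ) + C₀ ω‖ ^ p
      = (f₀ ω + g₀ ω) ^ 2 * (f₀ ω - f₁ ω) * α₁)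
    (heg : ∀ᵐ ω, ‖MissingFilter.weightSymbol s N K a ω * (f₀ ω : ℂ) - C₀ ω‖ ^ p
      = (f₀ ω + g₀ ω) ^ 2 * (g₀ ω - g₁ ω) * α₂)
    (hnf : 1 / (2 * Real.pi) * (∫ ω, |f₀ ω - f₁ ω| ^ 2) = ε₁)
    (hng : 1 / (2 * Real.pi) * (∫ ω, |g₀ ω - g₁ ω| ^ 2) = ε₂)
    (hext : MissingFilter.SolvesExtrem s N K a
      (MissingFilter.L2Ball f₁ ε₁ ×ˢ MissingFilter.L2Ball g₁ ε₂) f₀ g₀ C₀) :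
    MissingFilter.IsLeastFavorable s N K a
        (MissingFilter.L2Ball f₁ ε₁ ×ˢ MissingFilter.L2Ball g₁ ε₂) f₀ g₀ ∧
      MissingFilter.IsOptimal s N K a f₀ g₀ (MissingFilter.charFormula s N K a f₀ g₀ C₀) ∧
      MissingFilter.IsMinimaxRobust s N K a
        (MissingFilter.L2Ball f₁ ε₁ ×ˢ MissingFilter.L2Ball g₁ ε₂)
        (MissingFilter.charFormula s N K a f₀ g₀ C₀) := by 
  have hw := hmin.ae_pos hf₀.1 hg₀.1
  have hopt := hC₀.isOptimal ha hf₀.1 hg₀.1 hw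
  have hsaddle := hopt.isLeastFavorable_and_isMinimaxRobust (Set.mk_mem_prod hf₀ hg₀)
    fun q hq => MissingFilter.saddle_point hN hK ha hf₀.1 hg₀.1 hmin hC₀ hq.1.1 hq.2.1
      -- Convexity of the balls keeps the segment in `D`, so its minimal pairs are admissible in the
      -- extremal problem.
      fun t ht C hmint hC => hext.2 ⟨_, _, C, ⟨MissingFilter.mix_mem_L2Ball hf₁ ht hf₀ hq.1,
        MissingFilter.mix_mem_L2Ball hg₁ ht hg₀ hq.2⟩, hmint, hC, rfl⟩
  exact ⟨hsaddle.1, hopt, hsaddle.2⟩
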